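/- Let $\mathbb{F}$ be a field of characteristic zero, $\mathfrak{g}$ a Lie algebra over $\mathbb{F}$ with a vector space decomposition $\mathfrak{g}=\mathfrak{g}^-\oplus\mathfrak{g}^+$ (the summands need not be subalgebras), and let $s,t$ be commuting formal variables commuting with $\mathfrak{g}$. Let $\pi^\pm:\mathfrak{g}[[s,t]]\to\mathfrak{g}^\pm[[s,t]]$ be the corresponding projections. For $g^\pm\in\mathfrak{g}^\pm[[s,t]]$ let $\Psi^\pm\in\mathfrak{g}^\pm[[s,t]]$ be the unique elements with $$e^{tg^+}e^{sg^-}=e^{s\Psi^-}e^{t\Psi^+}\quad\text{in } U(\mathfrak{g})[[s,t]].$$ A *word* is a formal expression built from two letters by a binary bracket and two unary symbols $\pi^-,\pi^+$. A *series of words* is a formal, possibly infinite, linear combination of words in which, for all $m,n$, only finitely many words have exactly $m$ occurrences of the first letter and $n$ of the second. Substituting $sg^-$ and $tg^+$ for the letters, the bracket of $\mathfrak{g}[[s,t]]$ and the projections $\pi^\pm$, every series of words with coefficients in $\mathbb{F}$ has a well-defined value in $\mathfrak{g}[[s,t]]$; the space of all such values is denoted $\mathbb{F}\langle\langle sg^-,tg^+;\pi^\pm\rangle\rangle$,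 and $\mathbb{F}\langle\langle sg^-,tg^+;\pi^\pm\rangle\rangle^\pm$ is its intersection with $\mathfrak{g}^\pm[[s,t]]$. There are universal series of words $G^-,G^+$ with rational coefficients, independent of $\mathbb{F}$, $\mathfrak{g}$, the decomposition and $g^\pm$, such that in every such situation (the elements $\Psi^\pm$ exist, are unique, and) $$s\Psi^-,\,t\Psi^+\in\mathbb{F}\langle\langle sg^-,tg^+;\pi^\pm\rangle\rangle,\qquad s\Psi^-=G^-(sg^-,tg^+;\pi^\pm),\qquad t\Psi^+=G^+(sg^-,tg^+;\pi^\pm).$$ Their lowest-order terms are given, as formal series of words and hence also for their values, by $$G^-(sg^-,tg^+;\pi^\pm)=sg^-+\pi^-([tg^+,sg^-])+v^-,\qquad G^+(sg^-,tg^+;\pi^\pm)=tg^++\pi^+([tg^+,sg^-])+v^+,$$ where $v^\pm$ are universal series of words with rational coefficients, whose values lie in $\mathbb{F}\langle\langle sg^-,tg^+;\pi^\pm\rangle\rangle^\pm$, and which involve only words with at least three occurrences of $sg^-$ and $tg^+$ in total, including at least one of each. -/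

import Mathlib

open scoped Nat

namespace FormalUniformization

/-! Formal power series in two commuting variables `s` (index `0`) and `t` (index `1`)
with coefficients in a Lie algebra `g`; the coefficient of `s ^ m t ^ n` of `x` is the
value of `x` at the exponent `e` with `e 0 = m`, `e 1 = n`. -/

/-- The `F`-vector space `g[[s,t]]`. -/
abbrev LieSeries (g : Type*) := MvPowerSeries (Fin 2) g

section LieSeries

variable {F : Type*} [Field F] {g : Type*} [LieRing g] [LieAlgebra F g]

/-- The bracket of `g[[s,t]]`: the Cauchy product formed with the bracket of `g`. -/
noncomputable def bracket (x y : LieSeries g) : LieSeries g :=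
  fun e => ∑ p ∈ Finset.HasAntidiagonal.antidiagonal e, ⁅x p.1, y p.2⁆

/-- Multiplication of a series by the variable with index `i`. -/
noncomputable def mulVar (i : Fin 2) (x : LieSeries g) : LieSeries g :=
  fun e => if e i = 0 then 0 else x (e - Finsupp.single i 1)

/-- For a vector space decomposition `g = gm ⊕ gp`, the projection `π⁻` of `g[[s,t]]`
onto `gm[[s,t]]` along `gp[[s,t]]`. -/
noncomputable def projNegSeries {gm gp : Submodule F g} (hc : IsCompl gm gp)
    (x : LieSeries g) : LieSeries g :=
  fun e => gm.projection gp hc (x e)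

/-- For a vector space decomposition `g = gm ⊕ gp`, the projection `π⁺` of `g[[s,t]]`
onto `gp[[s,t]]` along `gm[[s,t]]`. -/
noncomputable def projPosSeries {gm gp : Submodule F g} (hc : IsCompl gm gp)
    (x : LieSeries g) : LieSeries g :=
  fun e => gp.projection gm hc.symm (x e)

/-- The subspace `V[[s,t]]` of `g[[s,t]]`, for a subspace `V` of `g`. -/
def seriesIn (V : Submodule F g) : Set (LieSeries g) :=
  {x | ∀ e, x e ∈ V}

variable (F) in
/-- The canonical map `g[[s,t]] → U(g)[[s,t]]`. -/
noncomputable def toEnveloping (x : LieSeries g) :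
    MvPowerSeries (Fin 2) (UniversalEnvelopingAlgebra F g) :=
  fun e => UniversalEnvelopingAlgebra.ι F (x e)

variable (F) in
/-- The exponential `∑ k, x ^ k / k!` in `U(g)[[s,t]]` of a series `x ∈ g[[s,t]]` with zero
constant term.  The coefficient of a monomial of total degree `d` in `x ^ k` vanishes for
`k > d`, so that only the exponents `k ≤ d` contribute to it. -/
noncomputable def expSeries (x : LieSeries g) :
    MvPowerSeries (Fin 2) (UniversalEnvelopingAlgebra F g) :=
  fun e => ∑ k ∈ Finset.range (e 0 + e 1 + 1),
    ((k ! : F)⁻¹) • MvPowerSeries.coeff e (toEnveloping F x ^ k)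

end LieSeries

/-- Formal words in two letters, built with a bracket and two unary symbols standing for
the projections `π⁻` and `π⁺`. -/
inductive Word : Type
  | neg : Word
  | pos : Word
  | br : Word → Word → Word
  | projNeg : Word → Word
  | projPos : Word → Word
  deriving DecidableEq

namespace Word

/-- Number of occurrences of the letter `neg`. -/
def degNeg : Word → ℕ
  | neg => 1
  | pos => 0
  | br v w => v.degNeg + w.degNeg
  | projNeg w => w.degNeg
  | projPos w => w.degNeg

/-- Number of occurrences of the letter `pos`. -/
def degPos : Word → ℕ
  | neg => 0
  | pos => 1
  | br v w => v.degPos + w.degPos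
  | projNeg w => w.degPos
  | projPos w => w.degPos

/-- The value in `g[[s,t]]` of a word: the letters are replaced by `a` and `b`, the
bracket is that of `g[[s,t]]`, and `π⁻`, `π⁺` are the coefficientwise projections. -/
noncomputable def eval {F : Type*} [Field F] {g : Type*} [LieRing g] [LieAlgebra F g]
    {gm gp : Submodule F g} (hc : IsCompl gm gp) (a b : LieSeries g) : Word → LieSeries g
  | neg => a
  | pos => b
  | br v w => bracket (v.eval hc a b) (w.eval hc a b)
  | projNeg w => projNegSeries hc (w.eval hc a b)
  | projPos w => projPosSeries hc (w.eval hc a b)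

/-- A word with `j` letters `s x` and `k` letters `t y` is divisible by `s ^ j t ^ k`. -/
theorem eval_eq_zero {F : Type*} [Field F] {g : Type*} [LieRing g] [LieAlgebra F g]
    {gm gp : Submodule F g} (hc : IsCompl gm gp) (x y : LieSeries g) (w : Word)
    (e : Fin 2 →₀ ℕ)   (h : e 0 < w.degNeg ∨ e 1 < w.degPos) :
    w.eval hc (mulVar 0 x) (mulVar 1 y) e = 0 := by
  induction w generalizing e with
  | neg => simp_all [eval, mulVar, degNeg, degPos]
  | pos => simp_all [eval, mulVar, degNeg, degPos]
  | br v w hv hw =>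
    refine Finset.sum_eq_zero fun p hp => ?_
    have hp' : p.1 + p.2 = e := Finset.HasAntidiagonal.mem_antidiagonal.mp hp
    have h0 : p.1 0 + p.2 0 = e 0 := by rw [← hp']; rfl
    have h1 : p.1 1 + p.2 1 = e 1 := by rw [← hp']; rfl
    simp only [degNeg, degPos] at h
    by_cases hv' : p.1 0 < v.degNeg ∨ p.1 1 < v.degPos
    · rw [hv _ hv', zero_lie]
    · rw [hw _ (by omega), lie_zero]
  | projNeg w hw => simp [eval, projNegSeries, hw e h]
  | projPos w hw => simp [eval, projPosSeries, hw e h]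

end Word

/-- Formal, possibly infinite, linear combinations of words, with only finitely many words
in each bidegree. -/
structure WordSeries (K : Type*) [Zero K] where
  coeff : Word → K
  finite_bidegree : ∀ j k : ℕ, {w | coeff w ≠ 0 ∧ w.degNeg = j ∧ w.degPos = k}.Finite

namespace WordSeries

/-- A series of words with rational coefficients, read over a field of characteristic zero. -/
def cast (F : Type*) [Field F] (S : WordSeries ℚ) : WordSeries F where
  coeff w := (S.coeff w : F)
  finite_bidegree j k := (S.finite_bidegree j k).subset fun w hw =>
    ⟨fun h => hw.1 (by rw [h, Rat.cast_zero]), hw.2⟩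

section eval

variable {F : Type*} [Field F] {g : Type*} [LieRing g] [LieAlgebra F g]

/-- The value `S(s x, t y; π^±)` in `g[[s,t]]` of a series of words: in each coefficient,
the sum over all words, which is finite by `finite_support` below. -/
noncomputable def eval (S : WordSeries F) {gm gp : Submodule F g} (hc : IsCompl gm gp)
    (x y : LieSeries g) : LieSeries g :=
  fun e => ∑ᶠ w : Word, S.coeff w • w.eval hc (mulVar 0 x) (mulVar 1 y) e

theorem finite_support (S : WordSeries F) {gm gp : Submodule F g} (hc : IsCompl gm gp)
    (x y : LieSeries g) (e : Fin 2 →₀ ℕ) :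
    (Function.support fun w : Word =>
      S.coeff w • w.eval hc (mulVar 0 x) (mulVar 1 y) e).Finite := by
  have hfin : (⋃ j ∈ Set.Iic (e 0), ⋃ k ∈ Set.Iic (e 1),
      {w : Word | S.coeff w ≠ 0 ∧ w.degNeg = j ∧ w.degPos = k}).Finite :=
    (Set.finite_Iic _).biUnion fun j _ =>
      (Set.finite_Iic _).biUnion fun k _ => S.finite_bidegree j k
  refine hfin.subset fun w hw => ?_
  have hw' : S.coeff w • w.eval hc (mulVar 0 x) (mulVar 1 y) e ≠ 0 := hw
  simp only [Set.mem_iUnion, Set.mem_Iic, Set.mem_ofPred_eq]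
  refine ⟨w.degNeg, ?_, w.degPos, ?_, fun h => hw' (by rw [h, zero_smul]), rfl, rfl⟩
  · by_contra h
    exact hw' (by rw [Word.eval_eq_zero hc x y w e (by omega), smul_zero])
  · by_contra h
    exact hw' (by rw [Word.eval_eq_zero hc x y w e (by omega), smul_zero])

/-- The formal completion `F⟨⟨s x, t y; π^±⟩⟩` inside `g[[s,t]]`: all formal infinite linear
combinations of words in `s x`, `t y`, brackets and the projections. -/
def completion {gm gp : Submodule F g} (hc : IsCompl gm gp) (x y : LieSeries g) : Set (LieSeries g) :=
  {z | ∃ S : WordSeries F, z = S.eval hc x y}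

end eval

/-- Every word of the series has at least three letters, and contains both letters. -/
def HigherMixed (V : WordSeries ℚ) : Prop :=
  ∀ w, V.coeff w ≠ 0 → 1 ≤ w.degNeg ∧ 1 ≤ w.degPos ∧ 3 ≤ w.degNeg + w.degPos

end WordSeries

end FormalUniformization

/-! Write `a = s g⁻`, `b = t g⁺` and rescale both by an auxiliary variable `τ`. One looks for `P(τ)`
in the minus part and `Q(τ)` in the plus part, both zero at `τ = 0`, with `e^(τ b) e^(τ a) = e^P
e^Q`. Both sides are `1` at `τ = 0`, so it is enough that their logarithmic derivatives `Y⁻¹ Y'`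
agree (`pexp_mul_pexp_eq`). That of `e^P e^Q` is `e^(-ad Q) φ(ad P) P' + φ(ad Q) Q'` with `φ(z) = (1
- e^(-z)) / z` (`mul_pexp`, `map_pexp`). Its linear part is `P' + Q'`, and the coefficient of `τ^n`
in the rest involves `P` and `Q` only up to `τ^n`. The equation thus reads `P' + Q' = rhs(P, Q)`,
and projecting it, `P' = π⁻ rhs`, `Q' = π⁺ rhs`, is a recursion for the coefficients.

The recursion uses only brackets, projections and rational numbers, so it is solved once and for all
among linear combinations of words (`exists_solution`). In degree `n` in `τ` it produces words with
`n` letters, so `τ = 1` can be substituted (`specOne`), which gives `G⁻` and `G⁺`. Trivial words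
such as `[neg, neg]` or `π⁻ pos` are simplified away on the spot. Hence every word other than a
single letter contains both letters, which gives the shape of the higher terms and the divisibility
of `G⁻` by `s` and of `G⁺` by `t`.

For uniqueness, suppose two factorizations agree below degree `n`. Then the sums of their exponents
agree in degree `n` inside `U(g)` (`isOrd_add_sub_add`), and directness of the decomposition
separates the summands. This needs `g → U(g)` to be injective. In characteristic zero this follows
from a faithful representation of `g` by left invariant formal vector fields on `g` itself: the
field of `x` solves `φ(ad y) V = x`, the Maurer-Cartan equation turns brackets into commutators
(`field_lie`), and `x` is the value of its field at the origin. -/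

namespace FormalUniformization

/-! ### Finite double sums and fixed points of triangular recursions. -/

section Summation

/-- A double sum over a square whose terms vanish above the antidiagonal. -/
theorem sum_range_sum_range_eq_sum_antidiagonal {M : Type*} [AddCommMonoid M] (N : ℕ)
    (f : ℕ → ℕ → M) (hf : ∀ i j, N ≤ i + j → f i j = 0) :
    ∑ i ∈ Finset.range N, ∑ j ∈ Finset.range N, f i j =
      ∑ k ∈ Finset.range N, ∑ p ∈ Finset.HasAntidiagonal.antidiagonal k, f p.1 p.2 := by
  rw [← Finset.sum_product', Finset.sum_sigma']
  symm
  refine Finset.sum_of_injOn (fun p => p.2) ?_ ?_ ?_ ?_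
  · rintro ⟨k, p⟩ hp ⟨l, q⟩ hq h
    simp only [Finset.coe_sigma, Set.mem_sigma_iff, Finset.mem_coe, Finset.mem_range,
      Finset.HasAntidiagonal.mem_antidiagonal] at hp hq h
    obtain ⟨-, rfl⟩ := hp
    obtain ⟨-, rfl⟩ := hq
    subst h
    rfl
  · rintro ⟨k, p⟩ hp
    simp only [Finset.coe_sigma, Set.mem_sigma_iff, Finset.mem_coe, Finset.mem_range,
      Finset.HasAntidiagonal.mem_antidiagonal] at hp
    simp only [Finset.coe_product, Set.mem_prod, Finset.mem_coe, Finset.mem_range]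
    omega
  · rintro p hp hp'
    refine hf _ _ (not_lt.mp fun h => hp' ⟨⟨p.1 + p.2, p⟩, ?_, rfl⟩)
    simpa using h
  · rintro ⟨k, p⟩ -
    rfl

/-- A self-map of a function space, each of whose values depends only on the values of its
argument in lower degree, has a fixed point, computed by iteration. -/
theorem exists_fixedPoint_of_causal {ι W : Type*} [Zero W] (deg : ι → ℕ)
    (Φ : (ι → W) → ι → W)
    (hΦ : ∀ n f h, (∀ i, deg i < n → f i = h i) → ∀ i, deg i < n + 1 → Φ f i = Φ h i) :
    ∃ f, Φ f = f ∧ ∀ i n, deg i < n → f i = Φ^[n] 0 i := by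
  have key : ∀ n m i, deg i < n → Φ^[n] 0 i = Φ^[n + m] 0 i := by
    intro n
    induction n with
    | zero => intro m i hi; omega
    | succ n ih =>
      intro m i hi
      rw [show n + 1 + m = (n + m) + 1 by ring, Function.iterate_succ_apply',
        Function.iterate_succ_apply']
      exact hΦ n _ _ (fun j hj => ih m j hj) i hi
  -- The diagonal of the iterates: values in degree `d` are stable from the iterate `d + 1` on.
  refine ⟨fun i => Φ^[deg i + 1] 0 i, ?_, fun i n hi => ?_⟩
  · funext i
    rw [Function.iterate_succ_apply']
    refine hΦ (deg i) _ _ (fun j hj => ?_) i (Nat.lt_succ_self _)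
    obtain ⟨m, hm⟩ := Nat.exists_eq_add_of_le (Nat.succ_le_of_lt hj)
    rw [hm]
    exact key _ _ _ (Nat.lt_succ_self _)
  · obtain ⟨m, rfl⟩ := Nat.exists_eq_add_of_le (Nat.succ_le_of_lt hi)
    exact key _ _ _ (Nat.lt_succ_self _)

end Summation

/-! ### The Maurer-Cartan equation, degree by degree. -/

section Commutator

variable {F M : Type*} [Field F] [CharZero F] [AddCommGroup M] [Module F M]

/-- The coefficient of `z ^ k` in `(1 - e ^ (-z)) / z`. -/
def phiCoeff (F : Type*) [Field F] (k : ℕ) : F := (-1) ^ k * ((k + 1)! : F)⁻¹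

/-- The inductions below use `φ` only through this recursion: weighting the term of index `k + 1` by
`k + 2` yields minus `ad` of the term of index `k`. -/
theorem succ_mul_phiCoeff (k : ℕ) :
    ((k : F) + 2) * phiCoeff F (k + 1) = -phiCoeff F k := by
  have h1 : ((k : F) + 2) ≠ 0 := by exact_mod_cast (Nat.succ_ne_zero (k + 1))
  have h2 : ((k + 1)! : F) ≠ 0 := by exact_mod_cast Nat.factorial_ne_zero _
  rw [phiCoeff, phiCoeff, Nat.factorial_succ (k + 1)]
  push_cast
  rw [show (k : F) + 1 + 1 = k + 2 by ring]
  field_simp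
  ring

/-- The flatness of the left Maurer-Cartan form `φ(T)`, where `T = ad y` and `D`, `D'` are
derivations with `D y = v`, `D' y = v'`, in each degree. -/
theorem maurerCartan_coeff (b : M →ₗ[F] M →ₗ[F] M) (hb : ∀ x y, b x y = -b y x)
    (T D D' : M →ₗ[F] M) (hT : ∀ x y, T (b x y) = b (T x) y + b x (T y)) (v v' : M)
    (hD : ∀ x, D (T x) = b v x + T (D x)) (hD' : ∀ x, D' (T x) = b v' x + T (D' x)) (k : ℕ) :
    phiCoeff F (k + 1) • (D ((T ^ (k + 1)) v') - (T ^ (k + 1)) (D v')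
        - D' ((T ^ (k + 1)) v) + (T ^ (k + 1)) (D' v))
      + ∑ p ∈ Finset.HasAntidiagonal.antidiagonal k,
          b (phiCoeff F p.1 • (T ^ p.1) v) (phiCoeff F p.2 • (T ^ p.2) v') = 0 := by
  set a : ℕ → M → M := fun k x => phiCoeff F k • (T ^ k) x with ha
  have ha0 : ∀ x, a 0 x = x := fun x => by simp [ha, phiCoeff]
  have has : ∀ (k : ℕ) x, ((k : F) + 2) • a (k + 1) x = -T (a k x) := fun k x => by
    simp only [ha]
    rw [smul_smul, succ_mul_phiCoeff, pow_succ', map_smul, neg_smul]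
    rfl
  set S : ℕ → M := fun k => ∑ p ∈ Finset.HasAntidiagonal.antidiagonal k, b (a p.1 v) (a p.2 v')
    with hS
  -- The weight `k + 3` of `S (k + 1)` is split as `(p.1 + 1) + (p.2 + 1)`; in each half the
  -- recursion lowers one index, and the index `0` leaves a boundary term.
  have hfirst : ∀ k : ℕ, ∑ p ∈ Finset.HasAntidiagonal.antidiagonal (k + 1),
      ((p.1 : F) + 1) • b (a p.1 v) (a p.2 v')
        = b v (a (k + 1) v') - ∑ p ∈ Finset.HasAntidiagonal.antidiagonal k,
            b (T (a p.1 v)) (a p.2 v') := fun k => by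
    rw [Finset.Nat.sum_antidiagonal_succ, sub_eq_add_neg, ← Finset.sum_neg_distrib]
    congr 1
    · simp [ha0]
    · refine Finset.sum_congr rfl fun p _ => ?_
      rw [← LinearMap.map_smul₂, show ((p.1 + 1 : ℕ) : F) + 1 = p.1 + 2 by push_cast; ring, has]
      simp
  have hsecond : ∀ k : ℕ, ∑ p ∈ Finset.HasAntidiagonal.antidiagonal (k + 1),
      ((p.2 : F) + 1) • b (a p.1 v) (a p.2 v')
        = b (a (k + 1) v) v' - ∑ p ∈ Finset.HasAntidiagonal.antidiagonal k,
            b (a p.1 v) (T (a p.2 v')) := fun k => by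
    rw [Finset.Nat.sum_antidiagonal_succ', sub_eq_add_neg, ← Finset.sum_neg_distrib]
    congr 1
    · simp [ha0]
    · refine Finset.sum_congr rfl fun p _ => ?_
      rw [← map_smul, show ((p.2 + 1 : ℕ) : F) + 1 = p.2 + 2 by push_cast; ring, has]
      simp
  have hSs : ∀ k : ℕ, ((k : F) + 3) • S (k + 1) =
      b v (a (k + 1) v') + b (a (k + 1) v) v' - T (S k) :=
    fun k => by
    have e : ((k : F) + 3) • S (k + 1) = ∑ p ∈ Finset.HasAntidiagonal.antidiagonal (k + 1),
        (((p.1 : F) + 1) • b (a p.1 v) (a p.2 v') + ((p.2 : F) + 1) • b (a p.1 v) (a p.2 v')) := by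
      rw [hS, Finset.smul_sum]
      refine Finset.sum_congr rfl fun p hp => ?_
      rw [← add_smul]
      congr 1
      have : p.1 + p.2 = k + 1 := Finset.HasAntidiagonal.mem_antidiagonal.mp hp
      have : (p.1 : F) + p.2 = k + 1 := by exact_mod_cast this
      linear_combination -this
    rw [e, Finset.sum_add_distrib, hfirst, hsecond, hS, map_sum]
    simp only [hT, Finset.sum_add_distrib]
    abel
  have hcast : ∀ k : ℕ, ((k : F) + 2) ≠ 0 := fun k => by exact_mod_cast (Nat.succ_ne_zero (k + 1))
  -- After weighting, the identity of index `k + 1` becomes `-T` of the identity of index `k`: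
  -- moving `D` and `D'` past `T` creates brackets with `v` and `v'`, which cancel the boundary
  -- terms of `hSs`.
  have goal : ∀ k : ℕ, D (a (k + 1) v') - a (k + 1) (D v') - D' (a (k + 1) v) + a (k + 1) (D' v)
      + S k = 0 := by
    intro k
    induction k with
    | zero =>
      refine (smul_eq_zero.mp ?_).resolve_left (hcast 0)
      simp only [smul_add, smul_sub, ← map_smul D, ← map_smul D', has]
      have hS0 : S 0 = b v v' := by simp [hS, ha0]
      simp only [ha0, map_neg, hD, hD', hS0, hb v' v]
      push_cast
      module
    | succ k ih =>
      refine (smul_eq_zero.mp ?_).resolve_left (hcast (k + 1))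
      simp only [smul_add, smul_sub, ← map_smul D, ← map_smul D', has]
      have := congrArg T ih
      simp only [map_add, map_sub, map_zero] at this
      rw [show (((k + 1 : ℕ) : F) + 2) = k + 3 by push_cast; ring, hSs]
      simp only [map_neg, hD, hD', hb v' (a (k + 1) v)]
      rw [← neg_eq_zero] at this
      rw [← this]
      abel
  have := goal k
  simp only [ha, hS, map_smul] at this ⊢
  rw [← this]
  module

end Commutator

/-! Formal power series maps `g → g`, given by their derivatives at the origin: the value of
`f : Jet g` at a multiset `s` is the iterated derivative of `f` at `0` in the directions in `s`. -/

/-- Formal maps from `g` to `g`, as functions of finite multisets of directions. -/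
abbrev Jet (g : Type*) := Multiset g → g

/-! ### Calculus of jets: pointwise brackets and derivatives along vector fields. -/

namespace Jet

section Basic

variable {F : Type*} [Field F] {g : Type*} [LieRing g] [LieAlgebra F g]

/-- The derivative of a formal map in a constant direction. -/
def deriv (w : g) (f : Jet g) : Jet g := fun s => f (w ::ₘ s)

/-- The pointwise bracket of formal maps. -/
def br (f h : Jet g) : Jet g :=
  fun s => ((Multiset.antidiagonal s).map fun p => ⁅f p.1, h p.2⁆).sum

/-- The derivative of `f` along the formal vector field `V`. -/
def act (V f : Jet g) : Jet g :=
  fun s => ((Multiset.antidiagonal s).map fun p => f (V p.1 ::ₘ p.2)).sum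

/-- The identity map. -/
def gen (g : Type*) [LieRing g] : Jet g := fun s => if s.card = 1 then s.sum else 0

/-- The constant map with value `x`. -/
def const (x : g) : Jet g := fun s => if s.card = 0 then x else 0

variable (F) in
/-- Linearity of a formal map in each direction. -/
def IsMultilin (f : Jet g) : Prop := ∀ s, IsLinearMap F fun w => f (w ::ₘ s)

theorem br_apply_zero (f h : Jet g) : br f h 0 = ⁅f 0, h 0⁆ := by simp [br]

theorem act_apply_zero (V f : Jet g) : act V f 0 = f {V 0} := by simp [act]

theorem deriv_add (w : g) (f h : Jet g) : deriv w (f + h) = deriv w f + deriv w h := rfl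

theorem deriv_sub (w : g) (f h : Jet g) : deriv w (f - h) = deriv w f - deriv w h := rfl

/-- With `deriv_act` this sets the proof scheme for identities between jets: check them at the empty
multiset, then peel off one direction by `deriv`, with all jets generalized in the induction. -/
theorem deriv_br (w : g) (f h : Jet g) :
    deriv w (br f h) = br (deriv w f) h + br f (deriv w h) := by
  funext s
  simp [deriv, br, Multiset.map_map, add_comm]

theorem deriv_act (w : g) (V f : Jet g) :
    deriv w (act V f) = act (deriv w V) f + act V (deriv w f) := by
  funext s
  simp [deriv, act, Multiset.map_map, add_comm, Multiset.cons_swap w]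

theorem br_add_left (f f' h : Jet g) : br (f + f') h = br f h + br f' h := by
  funext s
  simp [br, Multiset.sum_map_add]

theorem br_add_right (f h h' : Jet g) : br f (h + h') = br f h + br f h' := by
  funext s
  simp [br, Multiset.sum_map_add]

theorem br_smul_left (c : F) (f h : Jet g) : br (c • f) h = c • br f h := by
  funext s
  simp [br, Multiset.smul_sum, Multiset.map_map]

theorem br_smul_right (c : F) (f h : Jet g) : br f (c • h) = c • br f h := by
  funext s
  simp [br, Multiset.smul_sum, Multiset.map_map]

theorem act_add_right (V f h : Jet g) : act V (f + h) = act V f + act V h := by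
  funext s
  simp [act, Multiset.sum_map_add]

theorem act_smul_right (c : F) (V f : Jet g) : act V (c • f) = c • act V f := by
  funext s
  simp [act, Multiset.smul_sum, Multiset.map_map]

variable (F) in
/-- The pointwise bracket as a bilinear map. -/
def brLin : Jet g →ₗ[F] Jet g →ₗ[F] Jet g :=
  LinearMap.mk₂ F br br_add_left br_smul_left br_add_right br_smul_right

variable (F) in
/-- The derivative along a formal vector field as a linear map. -/
def actLin (V : Jet g) : Jet g →ₗ[F] Jet g where
  toFun := act V
  map_add' := act_add_right V
  map_smul' c := act_smul_right c V

theorem br_skew (f h : Jet g) : br f h = -br h f := by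
  funext s
  induction s using Multiset.induction_on generalizing f h with
  | empty => simp [br]
  | cons w s ih =>
    change deriv w (br f h) s = -deriv w (br h f) s
    rw [deriv_br, deriv_br, Pi.add_apply, Pi.add_apply, ih, ih f, Pi.neg_apply, Pi.neg_apply]
    abel

theorem br_leibniz (f h k : Jet g) : br f (br h k) = br (br f h) k + br h (br f k) := by
  funext s
  induction s using Multiset.induction_on generalizing f h k with
  | empty => simp [br]
  | cons w s ih =>
    change deriv w (br f (br h k)) s = deriv w (br (br f h) k + br h (br f k)) s
    simp only [deriv_br, deriv_add, br_add_left, br_add_right, Pi.add_apply]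
    rw [ih (deriv w f), ih f (deriv w h), ih f h]
    simp only [Pi.add_apply]
    abel

theorem act_br (V f h : Jet g) : act V (br f h) = br (act V f) h + br f (act V h) := by
  funext s
  induction s using Multiset.induction_on generalizing V f h with
  | empty =>
    simp only [Pi.add_apply, act_apply_zero, br_apply_zero]
    change deriv (V 0) (br f h) 0 = _
    rw [deriv_br, Pi.add_apply, br_apply_zero, br_apply_zero]
    rfl
  | cons w s ih =>
    change deriv w (act V (br f h)) s = deriv w (br (act V f) h + br f (act V h)) s
    simp only [deriv_br, deriv_act, deriv_add, act_add_right, br_add_left, br_add_right,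
      Pi.add_apply, ih]
    abel

theorem deriv_gen (w : g) : deriv w (gen g) = const w := by
  funext s
  by_cases h : s = 0
  · subst h
    simp [deriv, gen, const]
  · have : s.card ≠ 0 := by simpa using h
    simp [deriv, gen, const, h]

theorem deriv_const (w x : g) : deriv w (const x) = 0 := by
  funext s
  simp [deriv, const]

theorem act_const (V : Jet g) (x : g) : act V (const x) = 0 := by
  funext s
  simp [act, const]

theorem act_gen (V : Jet g) : act V (gen g) = V := by
  funext s
  induction s using Multiset.induction_on generalizing V with
  | empty => simp [act, gen]
  | cons w s ih =>
    change deriv w (act V (gen g)) s = deriv w V s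
    rw [deriv_act, Pi.add_apply, ih, deriv_gen, act_const]
    simp

theorem isMultilin_const (x : g) : IsMultilin F (const x) :=
  fun s => ⟨by simp [const], by simp [const]⟩

theorem isMultilin_gen : IsMultilin F (gen g) := fun s => by
  have : (fun w : g => gen g (w ::ₘ s)) = fun w => const w s := by
    funext w
    exact congrFun (deriv_gen w) s
  rw [this]
  by_cases h : s = 0
  · exact ⟨by simp [const, h], by simp [const, h]⟩
  · exact ⟨by simp [const, h], by simp [const, h]⟩

theorem IsMultilin.add {f h : Jet g} (hf : IsMultilin F f) (hh : IsMultilin F h) :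
    IsMultilin F (f + h) := fun s =>
  ⟨fun x y => by simp only [Pi.add_apply, (hf s).map_add, (hh s).map_add]; abel,
    fun c x => by simp only [Pi.add_apply, (hf s).map_smul, (hh s).map_smul, smul_add]⟩

theorem IsMultilin.smul {f : Jet g} (c : F) (hf : IsMultilin F f) :
    IsMultilin F (c • f) := fun s =>
  ⟨fun x y => by simp only [Pi.smul_apply, (hf s).map_add, smul_add],
    fun d x => by simp only [Pi.smul_apply, (hf s).map_smul, smul_comm c d]⟩

theorem isMultilin_zero : IsMultilin F (0 : Jet g) := fun s => ⟨by simp, by simp⟩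

variable (F g) in
/-- The formal maps that are linear in each direction. -/
def multilin : Submodule F (Jet g) where
  carrier := {f | IsMultilin F f}
  add_mem' := IsMultilin.add
  zero_mem' := isMultilin_zero
  smul_mem' := fun c _ => IsMultilin.smul c

theorem IsMultilin.deriv {f : Jet g} (hf : IsMultilin F f) (w : g) :
    IsMultilin F (deriv w f) := fun s =>
  ⟨fun x y => by simp only [Jet.deriv, Multiset.cons_swap w, (hf _).map_add],
    fun c x => by simp only [Jet.deriv, Multiset.cons_swap w, (hf _).map_smul]⟩

theorem IsMultilin.deriv_add_left {f : Jet g} (hf : IsMultilin F f) (v w : g) :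
    Jet.deriv (v + w) f = Jet.deriv v f + Jet.deriv w f :=
  funext fun s => (hf s).map_add v w

theorem IsMultilin.deriv_smul_left {f : Jet g} (hf : IsMultilin F f) (c : F) (w : g) :
    Jet.deriv (c • w) f = c • Jet.deriv w f :=
  funext fun s => (hf s).map_smul c w

theorem isMultilin_of_deriv {f : Jet g}
    (h1 : ∀ v w, Jet.deriv (v + w) f = Jet.deriv v f + Jet.deriv w f)
    (h2 : ∀ (c : F) w, Jet.deriv (c • w) f = c • Jet.deriv w f) : IsMultilin F f :=
  fun s => ⟨fun v w => congrFun (h1 v w) s, fun c w => congrFun (h2 c w) s⟩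

theorem IsMultilin.act_add_left {f : Jet g} (hf : IsMultilin F f) (V W : Jet g) :
    act (V + W) f = act V f + act W f := by
  funext s
  simp [act, (hf _).map_add, Multiset.sum_map_add]

theorem IsMultilin.act_smul_left {f : Jet g} (hf : IsMultilin F f) (c : F) (V : Jet g) :
    act (c • V) f = c • act V f := by
  funext s
  simp [act, (hf _).map_smul, Multiset.smul_sum, Multiset.map_map]

theorem IsMultilin.br {f h : Jet g} (hf : IsMultilin F f) (hh : IsMultilin F h) :
    IsMultilin F (br f h) := by
  refine isMultilin_of_deriv (fun v w => ?_) fun c w => ?_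
  · rw [deriv_br, deriv_br, deriv_br, hf.deriv_add_left, hh.deriv_add_left, br_add_left,
      br_add_right]
    abel
  · rw [deriv_br, deriv_br, hf.deriv_smul_left, hh.deriv_smul_left, br_smul_left,
      br_smul_right, smul_add]

theorem IsMultilin.act {V f : Jet g} (hV : IsMultilin F V) (hf : IsMultilin F f) :
    IsMultilin F (act V f) := by
  refine isMultilin_of_deriv (fun v w => ?_) fun c w => ?_
  · rw [deriv_act, deriv_act, deriv_act, hf.deriv_add_left, hV.deriv_add_left, act_add_right,
      hf.act_add_left]
    abel
  · rw [deriv_act, deriv_act, hf.deriv_smul_left, hV.deriv_smul_left, act_smul_right,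
      hf.act_smul_left, smul_add]

theorem IsMultilin.sub {f h : Jet g} (hf : IsMultilin F f) (hh : IsMultilin F h) :
    IsMultilin F (f - h) := (multilin F g).sub_mem hf hh

theorem IsMultilin.act_sub_left {f : Jet g} (hf : IsMultilin F f) (V W : Jet g) :
    Jet.act (V - W) f = Jet.act V f - Jet.act W f := by
  rw [eq_sub_iff_add_eq, ← hf.act_add_left, sub_add_cancel]

theorem IsMultilin.apply_sub {f : Jet g} (hf : IsMultilin F f) (v w : g) :
    f {v - w} = f {v} - f {w} := (hf 0).map_sub v w

/-- The derivatives along vector fields form a Lie algebra. -/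
theorem act_act_sub {V W f : Jet g} (hV : IsMultilin F V) (hW : IsMultilin F W)
    (hf : IsMultilin F f) :
    act V (act W f) - act W (act V f) = act (act V W - act W V) f := by
  funext s
  induction s using Multiset.induction_on generalizing V W f with
  | empty =>
    -- The second derivative of `f` is symmetric in `V 0` and `W 0`, so it cancels in the
    -- commutator.
    have h : ∀ V W : Jet g, act V (act W f) 0 = f {W {V 0}} + f (V 0 ::ₘ W 0 ::ₘ 0) := by
      intro V W
      rw [act_apply_zero]
      change deriv (V 0) (act W f) 0 = _
      rw [deriv_act, Pi.add_apply, act_apply_zero, act_apply_zero]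
      rfl
    rw [Pi.sub_apply, h, h, act_apply_zero, Pi.sub_apply, act_apply_zero, act_apply_zero,
      hf.apply_sub, Multiset.cons_swap]
    abel
  | cons w s ih =>
    change deriv w (act V (act W f) - act W (act V f)) s =
      deriv w (act (act V W - act W V) f) s
    have h1 := ih (hV.deriv w) hW hf
    have h2 := ih hV (hW.deriv w) hf
    have h3 := ih hV hW (hf.deriv w)
    simp only [deriv_act, deriv_sub, act_add_right, Pi.add_apply, Pi.sub_apply,
      hf.act_sub_left, (hf.deriv w).act_sub_left, hf.act_add_left] at h1 h2 h3 ⊢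
    linear_combination (norm := abel) h1 + h2 + h3

end Basic

end Jet

/-! ### The operator `φ(ad y)` on jets and its inversion. -/

namespace Jet

section Locality

variable {F : Type*} [Field F] {g : Type*} [LieRing g] [LieAlgebra F g]

theorem br_congr {f f' h h' : Jet g} {s : Multiset g}
    (hf : ∀ t, t.card ≤ s.card → f t = f' t) (hh : ∀ t, t.card ≤ s.card → h t = h' t) :
    br f h s = br f' h' s := by
  refine congrArg Multiset.sum (Multiset.map_congr rfl fun p hp => ?_)
  rw [← Multiset.mem_antidiagonal.mp hp, Multiset.card_add] at hf hh
  rw [hf _ (by omega), hh _ (by omega)]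

theorem act_congr {V f f' : Jet g} {s : Multiset g}
    (hf : ∀ t, t.card ≤ s.card + 1 → f t = f' t) : act V f s = act V f' s := by
  refine congrArg Multiset.sum (Multiset.map_congr rfl fun p hp => hf _ ?_)
  rw [← Multiset.mem_antidiagonal.mp hp, Multiset.card_add, Multiset.card_cons]
  omega

theorem br_eq_zero {f h : Jet g} {s : Multiset g} {m n : ℕ}
    (hf : ∀ t, t.card < m → f t = 0) (hh : ∀ t, t.card < n → h t = 0) (hs : s.card < m + n) :
    br f h s = 0 := by
  refine Multiset.sum_eq_zero fun x hx => ?_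
  obtain ⟨p, hp, rfl⟩ := Multiset.mem_map.mp hx
  have := congrArg Multiset.card (Multiset.mem_antidiagonal.mp hp)
  rw [Multiset.card_add] at this
  by_cases h1 : p.1.card < m
  · simp [hf _ h1]
  · simp [hh p.2 (by omega)]

/-- The jet `gen g` lives in cardinality one, so bracketing with it raises the order by one. -/
theorem br_gen_congr {f f' : Jet g} {n : ℕ} (hf : ∀ t, t.card < n → f t = f' t)
    {s : Multiset g} (hs : s.card < n + 1) : br (gen g) f s = br (gen g) f' s := by
  refine congrArg Multiset.sum (Multiset.map_congr rfl fun p hp => ?_)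
  have := congrArg Multiset.card (Multiset.mem_antidiagonal.mp hp)
  rw [Multiset.card_add] at this
  by_cases h1 : p.1.card = 1
  · rw [hf _ (by omega)]
  · simp [gen, h1]

theorem br_const (x y : g) : br (const x) (const y) = const ⁅x, y⁆ := by
  funext s
  induction s using Multiset.induction_on with
  | empty => simp [br, const]
  | cons w s ih =>
    change deriv w (br (const x) (const y)) s = deriv w (const ⁅x, y⁆) s
    simp [deriv_br, deriv_const, br]

variable (F) in
theorem pow_congr {f f' : Jet g} {n : ℕ} (hf : ∀ t, t.card < n → f t = f' t) (k : ℕ)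
    (s : Multiset g) (hs : s.card < n + k) :
    ((brLin F (gen g)) ^ k) f s = ((brLin F (gen g)) ^ k) f' s := by
  induction k generalizing s with
  | zero => exact hf s hs
  | succ k ih =>
    rw [pow_succ', Module.End.mul_apply, Module.End.mul_apply]
    exact br_gen_congr ih hs

variable (F) in
theorem pow_eq_zero_of_card (f : Jet g) (k : ℕ) (s : Multiset g) (hs : s.card < k) :
    ((brLin F (gen g)) ^ k) f s = 0 := by
  rw [pow_congr F (f' := 0) (n := 0) (by simp) k s (by omega), map_zero]
  rfl

variable (F) in
/-- The first `N` terms of `φ(ad y) = (1 - e ^ (-ad y)) / ad y`, where `y` is the identity map. -/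
def phiTrunc (N : ℕ) : Jet g →ₗ[F] Jet g :=
  ∑ k ∈ Finset.range N, phiCoeff F k • (brLin F (gen g)) ^ k

variable (F) in
/-- The operator `φ(ad y) = (1 - e ^ (-ad y)) / ad y`, where `y` is the identity map. -/
def phi (f : Jet g) : Jet g := fun s => phiTrunc F (s.card + 1) f s

theorem phiTrunc_apply (N : ℕ) (f : Jet g) (s : Multiset g) :
    phiTrunc F N f s =
      ∑ k ∈ Finset.range N, phiCoeff F k • ((brLin F (gen g)) ^ k) f s := by
  simp [phiTrunc, LinearMap.sum_apply, Finset.sum_apply]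

theorem phi_eq {N : ℕ} (f : Jet g) {s : Multiset g} (hs : s.card < N) :
    phi F f s = phiTrunc F N f s := by
  rw [phi, phiTrunc_apply, phiTrunc_apply]
  refine Finset.sum_subset (Finset.range_subset_range.mpr hs) fun k _ hk => ?_
  rw [pow_eq_zero_of_card F f k s (by simpa using hk), smul_zero]

theorem phi_add (f h : Jet g) : phi F (f + h) = phi F f + phi F h := by
  funext s
  simp [phi]

theorem phi_smul (c : F) (f : Jet g) : phi F (c • f) = c • phi F f := by
  funext s
  simp [phi]

theorem phi_sub_self (f : Jet g) (s : Multiset g) :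
    phi F f s - f s = ∑ k ∈ Finset.range s.card,
      phiCoeff F (k + 1) • ((brLin F (gen g)) ^ (k + 1)) f s := by
  rw [phi, phiTrunc_apply, Finset.sum_range_succ']
  simp [phiCoeff]

/-- As `φ(0) = 1`, the operator `phi` is the identity plus terms that raise the order. This
triangularity gives both its injectivity and the solution of `phi F V = const x`. -/
theorem phi_sub_congr {f f' : Jet g} {n : ℕ} (hf : ∀ t, t.card < n → f t = f' t)
    {s : Multiset g} (hs : s.card < n + 1) : phi F f s - f s = phi F f' s - f' s := by
  rw [phi_sub_self, phi_sub_self]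
  refine Finset.sum_congr rfl fun k _ => ?_
  rw [pow_congr F hf _ s (by omega)]

variable (F) in
theorem phi_injective : Function.Injective (phi F : Jet g → Jet g) := by
  intro f h hfh
  have key : ∀ n (t : Multiset g), t.card < n → f t = h t := by
    intro n
    induction n with
    | zero => intro t ht; omega
    | succ n ih =>
      intro t ht
      have := phi_sub_congr (F := F) ih ht
      rw [hfh] at this
      exact sub_right_injective this
  exact funext fun s => key _ s (Nat.lt_succ_self _)

theorem IsMultilin.pow {f : Jet g} (hf : IsMultilin F f) (k : ℕ) :
    IsMultilin F (((brLin F (gen g)) ^ k) f) := by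
  induction k with
  | zero => exact hf
  | succ k ih =>
    rw [pow_succ', Module.End.mul_apply]
    exact isMultilin_gen.br ih

theorem IsMultilin.phi {f : Jet g} (hf : IsMultilin F f) : IsMultilin F (phi F f) := by
  intro s
  have h : IsMultilin F (phiTrunc F (s.card + 2) f) := by
    rw [phiTrunc, LinearMap.sum_apply]
    exact (multilin F g).sum_mem fun k _ => (hf.pow k).smul _
  have e : (fun w => Jet.phi F f (w ::ₘ s)) = fun w => phiTrunc F (s.card + 2) f (w ::ₘ s) :=
    funext fun w => phi_eq f (by simp)
  rw [e]
  exact h s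

-- The equation is solved as the fixed point of `V = const x - (phi F V - V)`. Multilinearity
-- survives the limit because on all multisets `w ::ₘ s` with `s` fixed, `V` agrees with one
-- iterate, and each iterate is multilinear.
variable (F) in
theorem exists_phi_eq_const (x : g) : ∃ V : Jet g, IsMultilin F V ∧ phi F V = const x := by
  obtain ⟨V, hV, hV'⟩ := exists_fixedPoint_of_causal (W := g) Multiset.card
    (fun f s => const x s - (phi F f s - f s))
    (fun n f h hfh s hs => by rw [phi_sub_congr hfh hs])
  refine ⟨V, fun s => ?_, ?_⟩
  · have hit : ∀ n, IsMultilin F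
        ((fun (f : Jet g) s => const x s - (phi F f s - f s))^[n] 0) := by
      intro n
      induction n with
      | zero => exact isMultilin_zero
      | succ n ih =>
        rw [Function.iterate_succ_apply']
        exact (isMultilin_const x).sub (ih.phi.sub ih)
    have e : (fun w => V (w ::ₘ s)) = fun w =>
        (fun (f : Jet g) s => const x s - (phi F f s - f s))^[s.card + 2] 0 (w ::ₘ s) :=
      funext fun w => hV' _ _ (by simp)
    rw [e]
    exact hit _ s
  · funext s
    have := congrFun hV s
    rw [← sub_eq_zero] at this ⊢
    rw [← neg_eq_zero, ← this]
    abel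

end Locality

/-! ### Left invariant vector fields and the embedding of `g` in `U(g)`. -/

section Representation

variable (F : Type*) [Field F] {g : Type*} [LieRing g] [LieAlgebra F g]

/-- The left invariant formal vector field on `g` with value `x` at the origin. -/
noncomputable def field (x : g) : Jet g := (exists_phi_eq_const F x).choose

theorem isMultilin_field (x : g) : IsMultilin F (field F x) :=
  (exists_phi_eq_const F x).choose_spec.1

theorem phi_field (x : g) : phi F (field F x) = const x :=
  (exists_phi_eq_const F x).choose_spec.2

theorem field_apply_zero (x : g) : field F x 0 = x := by
  have := congrFun (phi_field F x) 0
  rw [phi, phiTrunc_apply] at this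
  simpa [phiCoeff, const] using this

theorem field_add (x y : g) : field F (x + y) = field F x + field F y := by
  refine phi_injective F ?_
  rw [phi_add, phi_field, phi_field, phi_field]
  funext s
  by_cases h : s = 0 <;> simp [const, h]

theorem field_smul (c : F) (x : g) : field F (c • x) = c • field F x := by
  refine phi_injective F ?_
  rw [phi_smul, phi_field, phi_field]
  funext s
  by_cases h : s = 0 <;> simp [const, h]

/-- The Maurer-Cartan equation with `φ(ad y) V = x` and `φ(ad y) W = y` constant: derivatives of
constants vanish, so what remains says that `phi` sends the commutator of the fields to the constant
`⁅x, y⁆`, and `phi` is injective. -/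
theorem field_lie [CharZero F] (x y : g) : field F ⁅x, y⁆ =
    act (field F x) (field F y) - act (field F y) (field F x) := by
  refine phi_injective F (funext fun s => ?_)
  set V := field F x with hV
  set W := field F y with hW
  -- `act` differentiates once, so the truncations must be exact up to cardinality `s.card + 1`.
  set N := s.card + 2 with hN
  have mc := fun k => maurerCartan_coeff (brLin F) br_skew (brLin F (gen g)) (actLin F V)
    (actLin F W) (fun f h => br_leibniz _ f h) V W
    (fun f => by
      change act V (br (gen g) f) = br V f + br (gen g) (act V f)
      rw [act_br, act_gen])
    (fun f => by
      change act W (br (gen g) f) = br W f + br (gen g) (act W f)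
      rw [act_br, act_gen]) k
  have hsum := Finset.sum_eq_zero fun k (_ : k ∈ Finset.range N) => mc k
  rw [Finset.sum_add_distrib] at hsum
  have h1 : ∑ k ∈ Finset.range N, phiCoeff F (k + 1) •
      (actLin F V (((brLin F (gen g)) ^ (k + 1)) W) - ((brLin F (gen g)) ^ (k + 1)) (actLin F V W)
        - actLin F W (((brLin F (gen g)) ^ (k + 1)) V)
        + ((brLin F (gen g)) ^ (k + 1)) (actLin F W V)) =
      act V (phiTrunc F (N + 1) W) - act W (phiTrunc F (N + 1) V)
        - phiTrunc F (N + 1) (act V W - act W V) := by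
    have e : ∀ X f : Jet g, act X (phiTrunc F (N + 1) f) =
        ∑ k ∈ Finset.range (N + 1), phiCoeff F k • actLin F X (((brLin F (gen g)) ^ k) f) := by
      intro X f
      change actLin F X (phiTrunc F (N + 1) f) = _
      simp [phiTrunc, LinearMap.sum_apply, map_sum]
    have e' : phiTrunc F (N + 1) (act V W - act W V) = ∑ k ∈ Finset.range (N + 1), phiCoeff F k •
        (((brLin F (gen g)) ^ k) (actLin F V W) - ((brLin F (gen g)) ^ k) (actLin F W V)) := by
      rw [phiTrunc, LinearMap.sum_apply]
      refine Finset.sum_congr rfl fun k _ => ?_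
      rw [← map_sub]
      rfl
    rw [e, e, e', ← Finset.sum_sub_distrib, ← Finset.sum_sub_distrib,
      Finset.sum_range_succ' _ N]
    refine (add_zero _).symm.trans (congrArg₂ _ ?_ ?_)
    · refine Finset.sum_congr rfl fun k _ => ?_
      rw [← smul_sub, ← smul_sub]
      congr 1
      abel
    -- The summand of index `0` vanishes, which is why the Maurer-Cartan sum can start at index `1`.
    · rw [← smul_sub, ← smul_sub]
      simp only [pow_zero, Module.End.one_apply]
      simp
  have h2 : (∑ k ∈ Finset.range N, ∑ p ∈ Finset.HasAntidiagonal.antidiagonal k,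
      brLin F (phiCoeff F p.1 • ((brLin F (gen g)) ^ p.1) V)
        (phiCoeff F p.2 • ((brLin F (gen g)) ^ p.2) W)) s =
      br (phiTrunc F N V) (phiTrunc F N W) s := by
    change _ = brLin F (phiTrunc F N V) (phiTrunc F N W) s
    simp only [phiTrunc, LinearMap.sum_apply, map_sum, Finset.sum_apply]
    rw [Finset.sum_comm, sum_range_sum_range_eq_sum_antidiagonal N]
    · rfl
    · intro i j hij
      refine br_eq_zero (m := i) (n := j) (fun t ht => ?_) (fun t ht => ?_) (by omega)
      · rw [LinearMap.smul_apply, Pi.smul_apply, pow_eq_zero_of_card F _ _ _ ht, smul_zero]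
      · rw [LinearMap.smul_apply, Pi.smul_apply, pow_eq_zero_of_card F _ _ _ ht, smul_zero]
  have hVN : ∀ M (t : Multiset g), t.card < M → phiTrunc F M V t = const x t := fun M t ht => by
    rw [← phi_eq V ht, hV, phi_field]
  have hWN : ∀ M (t : Multiset g), t.card < M → phiTrunc F M W t = const y t := fun M t ht => by
    rw [← phi_eq W ht, hW, phi_field]
  have hs := congrFun hsum s
  rw [Pi.add_apply, h1, h2, Pi.sub_apply, Pi.sub_apply,
    act_congr (f' := const y) fun t ht => hWN _ t (by omega),
    act_congr (f' := const x) fun t ht => hVN _ t (by omega),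
    br_congr (f' := const x) (h' := const y) (fun t ht => hVN _ t (by omega))
      (fun t ht => hWN _ t (by omega)), act_const, act_const, br_const,
    ← phi_eq _ (by omega : s.card < N + 1)] at hs
  rw [phi_field, ← sub_eq_zero]
  simp only [Pi.zero_apply] at hs
  rw [← hs]
  abel

attribute [local instance] LieRing.ofAssociativeRing

/-- The representation of `g` on formal maps by left invariant vector fields. -/
noncomputable def rep [CharZero F] : g →ₗ⁅F⁆ Module.End F (multilin F g) where
  toFun x := (actLin F (field F x)).restrict fun _ hf => (isMultilin_field F x).act hf
  map_add' x y := by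
    refine LinearMap.ext fun f => Subtype.ext ?_
    change act (field F (x + y)) f.1 = act (field F x) f.1 + act (field F y) f.1
    rw [field_add, IsMultilin.act_add_left f.2]
  map_smul' c x := by
    refine LinearMap.ext fun f => Subtype.ext ?_
    change act (field F (c • x)) f.1 = c • act (field F x) f.1
    rw [field_smul, IsMultilin.act_smul_left f.2]
  map_lie' {x y} := by
    refine LinearMap.ext fun f => Subtype.ext ?_
    change act (field F ⁅x, y⁆) f.1 = act (field F x) (act (field F y) f.1)
      - act (field F y) (act (field F x) f.1)
    rw [field_lie, act_act_sub (isMultilin_field F x) (isMultilin_field F y) f.2]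

/-- Letting the field of `x` act on the identity map and evaluating at the origin returns `x`. -/
theorem rep_injective [CharZero F] :
    Function.Injective (rep F : g → Module.End F (multilin F g)) := by
  intro x y h
  have := congrArg (fun D : Module.End F (multilin F g) => (D ⟨gen g, isMultilin_gen⟩).1 0) h
  change act (field F x) (gen g) 0 = act (field F y) (gen g) 0 at this
  rwa [act_gen, act_gen, field_apply_zero, field_apply_zero] at this

end Representation

end Jet

/-- In characteristic zero a Lie algebra embeds into its universal enveloping algebra. -/
theorem universalEnveloping_ι_injective (F : Type*) [Field F] [CharZero F] {g : Type*} [LieRing g]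
    [LieAlgebra F g] : Function.Injective (UniversalEnvelopingAlgebra.ι F : g → _) := by
  intro x y h
  refine Jet.rep_injective F ?_
  rw [← UniversalEnvelopingAlgebra.lift_ι_apply F (Jet.rep F) x, h,
    UniversalEnvelopingAlgebra.lift_ι_apply]

/-! ### Order of power series and convergent sums. -/

section Order

variable {σ R : Type*} [Ring R]

/-- All monomials of `f` have total degree at least `k`. -/
def IsOrd (k : ℕ) (f : MvPowerSeries σ R) : Prop :=
  ∀ e : σ →₀ ℕ, e.degree < k → MvPowerSeries.coeff e f = 0

theorem isOrd_zero (f : MvPowerSeries σ R) : IsOrd 0 f := fun _ h => absurd h (Nat.not_lt_zero _)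

theorem IsOrd.mono {k l : ℕ} {f : MvPowerSeries σ R} (h : IsOrd k f) (hl : l ≤ k) : IsOrd l f :=
  fun e he => h e (he.trans_le hl)

theorem IsOrd.add {k : ℕ} {f h : MvPowerSeries σ R} (hf : IsOrd k f) (hh : IsOrd k h) :
    IsOrd k (f + h) := fun e he => by rw [map_add, hf e he, hh e he, add_zero]

theorem IsOrd.sub {k : ℕ} {f h : MvPowerSeries σ R} (hf : IsOrd k f) (hh : IsOrd k h) :
    IsOrd k (f - h) := fun e he => by rw [map_sub, hf e he, hh e he, sub_zero]

theorem IsOrd.sum {ι : Type*} {s : Finset ι} {k : ℕ} {f : ι → MvPowerSeries σ R}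
    (hf : ∀ i ∈ s, IsOrd k (f i)) : IsOrd k (∑ i ∈ s, f i) := fun e he => by
  rw [map_sum]
  exact Finset.sum_eq_zero fun i hi => hf i hi e he

theorem IsOrd.mul {k l : ℕ} {f h : MvPowerSeries σ R} (hf : IsOrd k f) (hh : IsOrd l h) :
    IsOrd (k + l) (f * h) := fun e he => by
  classical
  rw [MvPowerSeries.coeff_mul]
  refine Finset.sum_eq_zero fun p hp => ?_
  have := congrArg Finsupp.degree (Finset.HasAntidiagonal.mem_antidiagonal.mp hp)
  rw [map_add] at this
  by_cases h1 : p.1.degree < k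
  · rw [hf _ h1, zero_mul]
  · rw [hh p.2 (by omega), mul_zero]

theorem IsOrd.pow {f : MvPowerSeries σ R} (hf : IsOrd 1 f) (k : ℕ) : IsOrd k (f ^ k) := by
  induction k with
  | zero => exact isOrd_zero _
  | succ k ih => rw [pow_succ]; exact ih.mul hf

/-- The sum of the series `f k`, in which each coefficient only takes into account the `f k`
with `k` at most its degree. -/
noncomputable def gradedSum (f : ℕ → MvPowerSeries σ R) : MvPowerSeries σ R :=
  fun e => ∑ k ∈ Finset.range (e.degree + 1), MvPowerSeries.coeff e (f k)

theorem coeff_gradedSum {f : ℕ → MvPowerSeries σ R} (hf : ∀ k, IsOrd k (f k)) {e : σ →₀ ℕ}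
    {N : ℕ} (hN : e.degree < N) :
    MvPowerSeries.coeff e (gradedSum f) = ∑ k ∈ Finset.range N, MvPowerSeries.coeff e (f k) :=
  Finset.sum_subset (Finset.range_subset_range.mpr hN) fun k _ hk =>
    hf k e (by simpa using hk)

theorem isOrd_gradedSum_sub {f : ℕ → MvPowerSeries σ R} (hf : ∀ k, IsOrd k (f k)) (N : ℕ) :
    IsOrd N (gradedSum f - ∑ k ∈ Finset.range N, f k) := fun e he => by
  rw [map_sub, coeff_gradedSum hf he, map_sum, sub_self]

theorem eq_of_isOrd_sub {f h : MvPowerSeries σ R} (H : ∀ N, IsOrd N (f - h)) : f = h := by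
  ext e
  have := H (e.degree + 1) e (Nat.lt_succ_self _)
  rwa [map_sub, sub_eq_zero] at this

theorem eq_gradedSum_of_isOrd_sub {f : ℕ → MvPowerSeries σ R} (hf : ∀ k, IsOrd k (f k))
    {h : MvPowerSeries σ R} (H : ∀ N, IsOrd N (h - ∑ k ∈ Finset.range N, f k)) :
    h = gradedSum f :=
  eq_of_isOrd_sub fun N => by
    have := (H N).sub (isOrd_gradedSum_sub hf N)
    rwa [sub_sub_sub_cancel_right] at this

theorem IsOrd.conv {f h : ℕ → MvPowerSeries σ R} (hf : ∀ k, IsOrd k (f k))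
    (hh : ∀ k, IsOrd k (h k)) (k : ℕ) :
    IsOrd k (∑ p ∈ Finset.HasAntidiagonal.antidiagonal k, f p.1 * h p.2) :=
  IsOrd.sum fun p hp => by
    rw [← Finset.HasAntidiagonal.mem_antidiagonal.mp hp]
    exact (hf _).mul (hh _)

/-- Modulo order `N` all sums become finite, and the products `f i * h j` with `N ≤ i + j` drop out.
-/
theorem gradedSum_mul {f h : ℕ → MvPowerSeries σ R} (hf : ∀ k, IsOrd k (f k))
    (hh : ∀ k, IsOrd k (h k)) :
    gradedSum f * gradedSum h =
      gradedSum fun k => ∑ p ∈ Finset.HasAntidiagonal.antidiagonal k, f p.1 * h p.2 := by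
  refine eq_of_isOrd_sub fun N => ?_
  have hF := isOrd_gradedSum_sub hf N
  have hH := isOrd_gradedSum_sub hh N
  have hC := isOrd_gradedSum_sub (IsOrd.conv hf hh) N
  set A := gradedSum f
  set B := gradedSum h
  set A' := ∑ k ∈ Finset.range N, f k with hA'
  set B' := ∑ k ∈ Finset.range N, h k with hB'
  have h1 : IsOrd N (A * B - A' * B') := by
    have e : A * B - A' * B' = (A - A') * B + A' * (B - B') := by noncomm_ring
    rw [e]
    exact ((hF.mul (isOrd_zero B)).mono (by simp)).add
      (((isOrd_zero A').mul hH).mono (by simp))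
  have h2 : IsOrd N (A' * B' - ∑ k ∈ Finset.range N,
      ∑ p ∈ Finset.HasAntidiagonal.antidiagonal k, f p.1 * h p.2) := fun e he => by
    rw [hA', hB', Finset.sum_mul_sum, map_sub, sub_eq_zero, map_sum, map_sum]
    simp only [map_sum]
    exact sum_range_sum_range_eq_sum_antidiagonal N _ fun i j hij =>
      ((hf i).mul (hh j)) e (he.trans_le hij)
  have := (h1.add h2).sub hC
  rw [sub_add_sub_cancel, sub_sub_sub_cancel_right] at this
  exact this

theorem mul_gradedSum (z : MvPowerSeries σ R) {f : ℕ → MvPowerSeries σ R}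
    (hf : ∀ k, IsOrd k (f k)) : z * gradedSum f = gradedSum fun k => z * f k :=
  eq_gradedSum_of_isOrd_sub (fun k => ((isOrd_zero z).mul (hf k)).mono (by simp)) fun N => by
    rw [← Finset.mul_sum, ← mul_sub]
    exact ((isOrd_zero z).mul (isOrd_gradedSum_sub hf N)).mono (by simp)

end Order

/-! ### Exponentials, conjugation and derivations in a noncommutative algebra. -/

section Exponential

variable {F : Type*} [Field F]

/-- The commutator with `q`. -/
def comm {S : Type*} [Ring S] (q z : S) : S := q * z - z * q

/-- The coefficient of `z ^ k` in `e ^ (-z)`. -/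
def expNegCoeff (F : Type*) [Field F] (k : ℕ) : F := (-1) ^ k * ((k ! : F))⁻¹

section Algebraic

variable [CharZero F] {S : Type*} [Ring S] [Algebra F S]

theorem succ_smul_pow (q : S) (n : ℕ) :
    ((n : F) + 1) • (((n + 1)! : F)⁻¹ • q ^ (n + 1)) = ((n ! : F)⁻¹ • q ^ n) * q := by
  have h1 : ((n : F) + 1) ≠ 0 := by exact_mod_cast Nat.succ_ne_zero n
  have h2 : (n ! : F) ≠ 0 := by exact_mod_cast Nat.factorial_ne_zero _
  rw [smul_smul, Nat.factorial_succ, smul_mul_assoc, ← pow_succ]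
  congr 1
  push_cast
  field_simp

theorem succ_smul_expNegCoeff (q z : S) (k : ℕ) :
    ((k : F) + 1) • (expNegCoeff F (k + 1) • (comm q)^[k + 1] z) =
      -comm q (expNegCoeff F k • (comm q)^[k] z) := by
  have h1 : ((k : F) + 1) ≠ 0 := by exact_mod_cast Nat.succ_ne_zero k
  have h2 : (k ! : F) ≠ 0 := by exact_mod_cast Nat.factorial_ne_zero _
  have h3 : ((k : F) + 1) * expNegCoeff F (k + 1) = -expNegCoeff F k := by
    rw [expNegCoeff, expNegCoeff, Nat.factorial_succ]
    push_cast
    field_simp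
    ring
  rw [smul_smul, h3, Function.iterate_succ_apply', comm, comm, neg_smul, smul_sub,
    mul_smul_comm, smul_mul_assoc]

theorem succ_smul_phiCoeff (q z : S) (k : ℕ) :
    ((k : F) + 2) • (phiCoeff F (k + 1) • (comm q)^[k + 1] z) =
      -comm q (phiCoeff F k • (comm q)^[k] z) := by
  rw [smul_smul, succ_mul_phiCoeff, Function.iterate_succ_apply', comm, comm, neg_smul, smul_sub,
    mul_smul_comm, smul_mul_assoc]

/-- The part of degree `n` in `q` of `z e^q = e^q (e^(-ad q) z)`. In the induction the weight `n +
1` is distributed as `p.1 + p.2`, and each part lowers one index by the recursions for `e` and `a`.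
-/
theorem mul_pow_div_factorial (q z : S) (n : ℕ) :
    z * ((n ! : F)⁻¹ • q ^ n) = ∑ p ∈ Finset.HasAntidiagonal.antidiagonal n,
      ((p.1 ! : F)⁻¹ • q ^ p.1) * (expNegCoeff F p.2 • (comm q)^[p.2] z) := by
  set e : ℕ → S := fun n => (n ! : F)⁻¹ • q ^ n with he
  set a : ℕ → S := fun k => expNegCoeff F k • (comm q)^[k] z with ha
  have hee : ∀ n : ℕ, ((n : F) + 1) • e (n + 1) = e n * q := succ_smul_pow q
  have haa : ∀ n : ℕ, ((n : F) + 1) • a (n + 1) = -comm q (a n) := succ_smul_expNegCoeff q z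
  change z * e n = ∑ p ∈ Finset.HasAntidiagonal.antidiagonal n, e p.1 * a p.2
  have hqe : ∀ n, q * e n = e n * q := fun n => by
    rw [he, mul_smul_comm, smul_mul_assoc, ← pow_succ', ← pow_succ]
  induction n with
  | zero => simp [he, ha, expNegCoeff]
  | succ n ih =>
    have h1 : ((n : F) + 1) ≠ 0 := by exact_mod_cast Nat.succ_ne_zero n
    refine smul_right_injective S h1 ?_
    change ((n : F) + 1) • _ = ((n : F) + 1) • _
    rw [← mul_smul_comm, hee, ← mul_assoc, ih]
    have split : ((n : F) + 1) • ∑ p ∈ Finset.HasAntidiagonal.antidiagonal (n + 1), e p.1 * a p.2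
        = ∑ p ∈ Finset.HasAntidiagonal.antidiagonal (n + 1), (p.1 : F) • (e p.1 * a p.2)
          + ∑ p ∈ Finset.HasAntidiagonal.antidiagonal (n + 1), (p.2 : F) • (e p.1 * a p.2) := by
      rw [← Finset.sum_add_distrib, Finset.smul_sum]
      refine Finset.sum_congr rfl fun p hp => ?_
      rw [← add_smul]
      congr 1
      exact_mod_cast (Finset.HasAntidiagonal.mem_antidiagonal.mp hp).symm
    rw [split, Finset.Nat.sum_antidiagonal_succ, Finset.Nat.sum_antidiagonal_succ']
    simp only [Nat.cast_zero, zero_smul, zero_add, Nat.cast_add, Nat.cast_one]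
    rw [← Finset.sum_add_distrib, Finset.sum_mul]
    refine Finset.sum_congr rfl fun p _ => ?_
    rw [← smul_mul_assoc, ← mul_smul_comm, hee, haa, comm]
    noncomm_ring

/-- One degree of `d(e^q) = e^q φ(ad q)(d q)`. The induction is that of `mul_pow_div_factorial`,
with the weight `n + 2` distributed as `p.1 + (p.2 + 1)` to suit the recursion of `φ`. -/
theorem map_pow_div_factorial (d : S →ₗ[F] S) (hd : ∀ x y, d (x * y) = d x * y + x * d y)
    (q : S) (n : ℕ) :
    d (((n + 1)! : F)⁻¹ • q ^ (n + 1)) = ∑ p ∈ Finset.HasAntidiagonal.antidiagonal n,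
      ((p.1 ! : F)⁻¹ • q ^ p.1) * (phiCoeff F p.2 • (comm q)^[p.2] (d q)) := by
  set e : ℕ → S := fun n => (n ! : F)⁻¹ • q ^ n with he
  set a : ℕ → S := fun k => phiCoeff F k • (comm q)^[k] (d q) with ha
  have hee : ∀ n : ℕ, ((n : F) + 1) • e (n + 1) = e n * q := succ_smul_pow q
  have haa : ∀ n : ℕ, ((n : F) + 2) • a (n + 1) = -comm q (a n) := succ_smul_phiCoeff q (d q)
  change d (e (n + 1)) = ∑ p ∈ Finset.HasAntidiagonal.antidiagonal n, e p.1 * a p.2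
  induction n with
  | zero => simp [he, ha, phiCoeff]
  | succ n ih =>
    have h1 : ((n : F) + 2) ≠ 0 := by exact_mod_cast Nat.succ_ne_zero (n + 1)
    refine smul_right_injective S h1 ?_
    change ((n : F) + 2) • _ = ((n : F) + 2) • _
    have hee' : ((n : F) + 2) • e (n + 1 + 1) = e (n + 1) * q := by
      rw [← hee (n + 1)]
      congr 1
      push_cast
      ring
    rw [← map_smul, hee', hd, ih]
    have split : ((n : F) + 2) • ∑ p ∈ Finset.HasAntidiagonal.antidiagonal (n + 1), e p.1 * a p.2
        = ∑ p ∈ Finset.HasAntidiagonal.antidiagonal (n + 1), (p.1 : F) • (e p.1 * a p.2)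
          + ∑ p ∈ Finset.HasAntidiagonal.antidiagonal (n + 1),
              ((p.2 : F) + 1) • (e p.1 * a p.2) := by
      rw [← Finset.sum_add_distrib, Finset.smul_sum]
      refine Finset.sum_congr rfl fun p hp => ?_
      rw [← add_smul]
      congr 1
      have : (p.1 : F) + p.2 = n + 1 := by
        exact_mod_cast (Finset.HasAntidiagonal.mem_antidiagonal.mp hp)
      linear_combination -this
    rw [split, Finset.Nat.sum_antidiagonal_succ, Finset.Nat.sum_antidiagonal_succ']
    have ha0 : a 0 = d q := by simp [ha, phiCoeff]
    simp only [Nat.cast_zero, zero_smul, zero_add, Nat.cast_add, Nat.cast_one, one_smul, ha0]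
    rw [add_comm (e (n + 1) * d q), ← add_assoc, ← Finset.sum_add_distrib, Finset.sum_mul]
    congr 1
    refine Finset.sum_congr rfl fun p _ => ?_
    rw [add_assoc, one_add_one_eq_two, ← smul_mul_assoc, ← mul_smul_comm, hee, haa, comm]
    noncomm_ring

end Algebraic

variable {σ R : Type*} [Ring R] [Algebra F R]

theorem IsOrd.smul {k : ℕ} (c : F) {f : MvPowerSeries σ R} (hf : IsOrd k f) :
    IsOrd k (c • f) := fun e he => by
  change c • MvPowerSeries.coeff e f = 0
  rw [hf e he, smul_zero]

theorem IsOrd.comm {k l : ℕ} {f h : MvPowerSeries σ R} (hf : IsOrd k f) (hh : IsOrd l h) :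
    IsOrd (k + l) (comm f h) :=
  (hf.mul hh).sub (by rw [add_comm]; exact hh.mul hf)

theorem IsOrd.iterate_comm {q : MvPowerSeries σ R} (hq : IsOrd 1 q) (z : MvPowerSeries σ R)
    (k : ℕ) : IsOrd k ((FormalUniformization.comm q)^[k] z) := by
  induction k with
  | zero => exact isOrd_zero _
  | succ k ih =>
    rw [Function.iterate_succ_apply', add_comm]
    exact hq.comm ih

variable (F) in
/-- The exponential of a power series without constant term. -/
noncomputable def pexp (x : MvPowerSeries σ R) : MvPowerSeries σ R :=
  gradedSum fun k => (k ! : F)⁻¹ • x ^ k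

/-- The value at `ad q` of the power series with coefficients `c`, applied to `z`. -/
noncomputable def adSeries (c : ℕ → F) (q z : MvPowerSeries σ R) : MvPowerSeries σ R :=
  gradedSum fun k => c k • (comm q)^[k] z

theorem isOrd_pexp_term {x : MvPowerSeries σ R} (hx : IsOrd 1 x) (k : ℕ) :
    IsOrd k ((k ! : F)⁻¹ • x ^ k) := (hx.pow k).smul _

theorem isOrd_adSeries_term (c : ℕ → F) {q : MvPowerSeries σ R} (hq : IsOrd 1 q)
    (z : MvPowerSeries σ R) (k : ℕ) : IsOrd k (c k • (comm q)^[k] z) :=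
  (hq.iterate_comm z k).smul _

theorem mul_pexp [CharZero F] {q : MvPowerSeries σ R} (hq : IsOrd 1 q) (z : MvPowerSeries σ R) :
    z * pexp F q = pexp F q * adSeries (expNegCoeff F) q z := by
  rw [pexp, adSeries, gradedSum_mul (isOrd_pexp_term hq) (isOrd_adSeries_term _ hq z),
    mul_gradedSum z (isOrd_pexp_term hq)]
  congr 1
  funext n
  exact mul_pow_div_factorial q z n

theorem map_pexp [CharZero F] (d : MvPowerSeries σ R →ₗ[F] MvPowerSeries σ R)
    (hd : ∀ x y, d (x * y) = d x * y + x * d y) (hord : ∀ k f, IsOrd (k + 1) f → IsOrd k (d f))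
    {q : MvPowerSeries σ R} (hq : IsOrd 1 q) :
    d (pexp F q) = pexp F q * adSeries (phiCoeff F) q (d q) := by
  have hd1 : d 1 = 0 := by simpa using hd 1 1
  rw [adSeries]
  conv_rhs => rw [pexp]
  rw [gradedSum_mul (isOrd_pexp_term hq) (isOrd_adSeries_term _ hq _)]
  refine eq_gradedSum_of_isOrd_sub
    (IsOrd.conv (isOrd_pexp_term hq) (isOrd_adSeries_term _ hq _)) fun N => ?_
  -- `d` lowers the order by at most one, so an error of order `N + 1` is needed; the extra summand
  -- is `d 1 = 0`.
  have := hord N _ (isOrd_gradedSum_sub (isOrd_pexp_term (F := F) hq) (N + 1))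
  rw [map_sub, Finset.sum_range_succ', map_add, map_sum] at this
  simp only [map_pow_div_factorial d hd] at this
  simpa [hd1, pexp] using this

end Exponential

/-! ### Logarithmic derivatives in the auxiliary variable `τ`. -/

section OneVariable

variable (F : Type*) [Field F] {A : Type*} [Ring A] [Algebra F A]

theorem isOrd_powerSeries {k : ℕ} {f : PowerSeries A} :
    IsOrd k f ↔ ∀ n < k, PowerSeries.coeff n f = 0 := by
  constructor
  · intro h n hn
    exact h (Finsupp.single () n) (by rwa [Finsupp.degree_single])
  · intro h e he
    have e' : e = Finsupp.single () e.degree := by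
      ext
      rw [Finsupp.degree_eq_sum]
      simp
    rw [e']
    exact h _ he

theorem coeff_smul_algebra (c : F) (f : PowerSeries A) (n : ℕ) :
    PowerSeries.coeff n (c • f) = c • PowerSeries.coeff n f := rfl

/-- The derivative of a power series with coefficients in a noncommutative algebra. -/
noncomputable def tderiv : PowerSeries A →ₗ[F] PowerSeries A where
  toFun f := PowerSeries.mk fun n => ((n : F) + 1) • PowerSeries.coeff (n + 1) f
  map_add' f h := by ext n; simp
  map_smul' c f := by
    ext n
    rw [RingHom.id_apply, PowerSeries.coeff_mk, coeff_smul_algebra, coeff_smul_algebra,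
      PowerSeries.coeff_mk, smul_comm]

theorem coeff_tderiv (f : PowerSeries A) (n : ℕ) :
    PowerSeries.coeff n (tderiv F f) = ((n : F) + 1) • PowerSeries.coeff (n + 1) f :=
  PowerSeries.coeff_mk n fun n => ((n : F) + 1) • PowerSeries.coeff (n + 1) f

theorem tderiv_mul (f h : PowerSeries A) :
    tderiv F (f * h) = tderiv F f * h + f * tderiv F h := by
  ext n
  rw [coeff_tderiv, map_add, PowerSeries.coeff_mul, PowerSeries.coeff_mul, PowerSeries.coeff_mul]
  have split : ((n : F) + 1) • ∑ p ∈ Finset.HasAntidiagonal.antidiagonal (n + 1),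
        PowerSeries.coeff p.1 f * PowerSeries.coeff p.2 h
      = ∑ p ∈ Finset.HasAntidiagonal.antidiagonal (n + 1),
          (p.1 : F) • (PowerSeries.coeff p.1 f * PowerSeries.coeff p.2 h)
        + ∑ p ∈ Finset.HasAntidiagonal.antidiagonal (n + 1),
          (p.2 : F) • (PowerSeries.coeff p.1 f * PowerSeries.coeff p.2 h) := by
    rw [← Finset.sum_add_distrib, Finset.smul_sum]
    refine Finset.sum_congr rfl fun p hp => ?_
    rw [← add_smul]
    congr 1
    exact_mod_cast congrArg (Nat.cast (R := F))
      (Finset.HasAntidiagonal.mem_antidiagonal.mp hp).symm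
  rw [split, Finset.Nat.sum_antidiagonal_succ, Finset.Nat.sum_antidiagonal_succ']
  simp only [Nat.cast_zero, zero_smul, zero_add, Nat.cast_add, Nat.cast_one,
    coeff_tderiv, smul_mul_assoc, mul_smul_comm]

theorem isOrd_tderiv (k : ℕ) (f : PowerSeries A) (hf : IsOrd (k + 1) f) :
    IsOrd k (tderiv F f) :=
  isOrd_powerSeries.mpr fun n hn => by
    rw [coeff_tderiv, isOrd_powerSeries.mp hf _ (by omega), smul_zero]

/-- Uniqueness for the linear differential equation `Y' = Y r`. -/
theorem eq_of_tderiv_eq_mul [CharZero F] {Y Z r : PowerSeries A} (hY : tderiv F Y = Y * r)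
    (hZ : tderiv F Z = Z * r) (h0 : PowerSeries.coeff 0 Y = PowerSeries.coeff 0 Z) : Y = Z := by
  ext n
  induction n using Nat.strong_induction_on with
  | _ n ih =>
    match n with
    | 0 => exact h0
    | n + 1 =>
      have h1 : ((n : F) + 1) ≠ 0 := by exact_mod_cast Nat.succ_ne_zero n
      refine smul_right_injective A h1 ?_
      change ((n : F) + 1) • _ = ((n : F) + 1) • _
      rw [← coeff_tderiv, ← coeff_tderiv, hY, hZ, PowerSeries.coeff_mul, PowerSeries.coeff_mul]
      refine Finset.sum_congr rfl fun p hp => ?_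
      have := Finset.HasAntidiagonal.mem_antidiagonal.mp hp
      rw [ih p.1 (by omega)]

theorem coeff_zero_pexp (x : PowerSeries A) : PowerSeries.coeff 0 (pexp F x) = 1 := by
  change MvPowerSeries.coeff (Finsupp.single () 0) (gradedSum _) = 1
  change ∑ k ∈ Finset.range ((Finsupp.single () 0).degree + 1), _ = _
  rw [Finsupp.degree_single]
  simp

/-- The logarithmic derivative of a product of two exponentials. -/
theorem tderiv_pexp_mul_pexp [CharZero F] {P Q : PowerSeries A} (hP : IsOrd 1 P)
    (hQ : IsOrd 1 Q) :
    tderiv F (pexp F P * pexp F Q) = pexp F P * pexp F Q *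
      (adSeries (expNegCoeff F) Q (adSeries (phiCoeff F) P (tderiv F P))
        + adSeries (phiCoeff F) Q (tderiv F Q)) := by
  have h1 : tderiv F (pexp F P) = pexp F P * adSeries (phiCoeff F) P (tderiv F P) :=
    map_pexp (tderiv F) (tderiv_mul F) (isOrd_tderiv F) hP
  have h2 : tderiv F (pexp F Q) = pexp F Q * adSeries (phiCoeff F) Q (tderiv F Q) :=
    map_pexp (tderiv F) (tderiv_mul F) (isOrd_tderiv F) hQ
  have h3 := mul_pexp (F := F) hQ (adSeries (phiCoeff F) P (tderiv F P))
  rw [tderiv_mul, h1, h2, mul_add, mul_assoc (pexp F P), mul_assoc (pexp F P),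
    mul_assoc (pexp F P), h3]

/-- Two products of exponentials agree if their logarithmic derivatives do. -/
theorem pexp_mul_pexp_eq [CharZero F] {P Q P' Q' : PowerSeries A} (hP : IsOrd 1 P)
    (hQ : IsOrd 1 Q) (hP' : IsOrd 1 P') (hQ' : IsOrd 1 Q')
    (h : adSeries (expNegCoeff F) Q (adSeries (phiCoeff F) P (tderiv F P))
        + adSeries (phiCoeff F) Q (tderiv F Q) =
      adSeries (expNegCoeff F) Q' (adSeries (phiCoeff F) P' (tderiv F P'))
        + adSeries (phiCoeff F) Q' (tderiv F Q')) :
    pexp F P * pexp F Q = pexp F P' * pexp F Q' := by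
  refine eq_of_tderiv_eq_mul F (tderiv_pexp_mul_pexp F hP hQ) ?_ ?_
  · rw [h]
    exact tderiv_pexp_mul_pexp F hP' hQ'
  · have key : ∀ X Y : PowerSeries A, PowerSeries.coeff 0 (pexp F X * pexp F Y) = 1 := by
      intro X Y
      refine (PowerSeries.coeff_mul 0 _ _).trans ?_
      simp [coeff_zero_pexp]
    rw [key, key]

end OneVariable

/-! ### Setting `τ = 1`. -/

section Specialization

variable (F : Type*) [Field F] {σ R : Type*} [Ring R] [Algebra F R]

/-- The value at `τ = 1` of a power series in `τ` whose coefficients have increasing order. -/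
noncomputable def specOne (f : PowerSeries (MvPowerSeries σ R)) : MvPowerSeries σ R :=
  gradedSum fun n => PowerSeries.coeff n f

/-- The coefficient of `τ ^ n` has order at least `n`. -/
def IsAdapted (f : PowerSeries (MvPowerSeries σ R)) : Prop :=
  ∀ n, IsOrd n (PowerSeries.coeff n f)

theorem IsAdapted.mul {f h : PowerSeries (MvPowerSeries σ R)} (hf : IsAdapted f)
    (hh : IsAdapted h) : IsAdapted (f * h) := fun n => by
  rw [PowerSeries.coeff_mul]
  exact IsOrd.conv hf hh n

theorem specOne_mul {f h : PowerSeries (MvPowerSeries σ R)} (hf : IsAdapted f)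
    (hh : IsAdapted h) : specOne (f * h) = specOne f * specOne h := by
  rw [specOne, specOne, specOne, gradedSum_mul hf hh]
  congr 1
  funext n
  rw [PowerSeries.coeff_mul]

theorem isAdapted_one : IsAdapted (1 : PowerSeries (MvPowerSeries σ R)) := fun n => by
  rcases n with _ | n
  · exact isOrd_zero _
  · intro e _
    simp [PowerSeries.coeff_one]

theorem specOne_one : specOne (1 : PowerSeries (MvPowerSeries σ R)) = 1 := by
  ext e
  rw [specOne, coeff_gradedSum isAdapted_one (Nat.lt_succ_self _), Finset.sum_range_succ']
  simp [PowerSeries.coeff_one]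

theorem IsAdapted.pow {f : PowerSeries (MvPowerSeries σ R)} (hf : IsAdapted f) (k : ℕ) :
    IsAdapted (f ^ k) := by
  induction k with
  | zero => rw [pow_zero]; exact isAdapted_one
  | succ k ih => rw [pow_succ]; exact ih.mul hf

theorem specOne_pow {f : PowerSeries (MvPowerSeries σ R)} (hf : IsAdapted f) (k : ℕ) :
    specOne (f ^ k) = specOne f ^ k := by
  induction k with
  | zero => rw [pow_zero, pow_zero, specOne_one]
  | succ k ih => rw [pow_succ, pow_succ, specOne_mul (hf.pow k) hf, ih]

theorem coeff_pexp {A : Type*} [Ring A] [Algebra F A] {x : PowerSeries A} (hx : IsOrd 1 x)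
    {n N : ℕ} (hN : n < N) :
    PowerSeries.coeff n (pexp F x) =
      ∑ k ∈ Finset.range N, (k ! : F)⁻¹ • PowerSeries.coeff n (x ^ k) :=
  coeff_gradedSum (isOrd_pexp_term hx) (by rwa [Finsupp.degree_single])

theorem IsAdapted.pexp {f : PowerSeries (MvPowerSeries σ R)} (hf : IsAdapted f)
    (hf1 : IsOrd 1 f) : IsAdapted (pexp F f) := fun n => by
  rw [coeff_pexp F hf1 (Nat.lt_succ_self n)]
  exact IsOrd.sum fun k _ => ((hf.pow k) n).smul _

theorem isOrd_specOne {f : PowerSeries (MvPowerSeries σ R)} (hf : IsAdapted f)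
    (hf1 : IsOrd 1 f) : IsOrd 1 (specOne f) := fun e he => by
  rw [specOne, coeff_gradedSum hf he]
  simp [isOrd_powerSeries.mp hf1 0]

/-- At a fixed monomial, the power `k` and the `τ`-degree `n` are both bounded by its degree, so
this is an exchange of two finite sums. -/
theorem specOne_pexp {f : PowerSeries (MvPowerSeries σ R)} (hf : IsAdapted f)
    (hf1 : IsOrd 1 f) : specOne (FormalUniformization.pexp F f) =
      FormalUniformization.pexp F (specOne f) := by
  ext e
  have hlt := Nat.lt_succ_self e.degree
  rw [specOne, coeff_gradedSum (hf.pexp F hf1) hlt]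
  refine Eq.trans ?_ (coeff_gradedSum (isOrd_pexp_term (isOrd_specOne hf hf1)) hlt).symm
  have h1 : ∀ n ∈ Finset.range (e.degree + 1),
      MvPowerSeries.coeff e (PowerSeries.coeff n (FormalUniformization.pexp F f)) =
        ∑ k ∈ Finset.range (e.degree + 1),
          (k ! : F)⁻¹ • MvPowerSeries.coeff e (PowerSeries.coeff n (f ^ k)) := fun n hn => by
    rw [coeff_pexp F hf1 (Finset.mem_range.mp hn), map_sum]
    rfl
  rw [Finset.sum_congr rfl h1, Finset.sum_comm]
  refine Finset.sum_congr rfl fun k _ => ?_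
  rw [← Finset.smul_sum]
  change _ = (k ! : F)⁻¹ • MvPowerSeries.coeff e (specOne f ^ k)
  rw [← specOne_pow hf, specOne, coeff_gradedSum (hf.pow k) hlt]

end Specialization

/-! ### Comparing two products of exponentials to lowest order. -/

section Uniqueness

variable {F : Type*} [Field F] {σ R : Type*} [Ring R] [Algebra F R]

theorem pow_sub_pow_isOrd {x y : MvPowerSeries σ R} (hx : IsOrd 1 x) (hy : IsOrd 1 y) {n : ℕ}
    (h : IsOrd n (x - y)) (k : ℕ) : IsOrd (n + k) (x ^ (k + 1) - y ^ (k + 1)) := by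
  induction k with
  | zero => simpa using h
  | succ k ih =>
    have e : x ^ (k + 1 + 1) - y ^ (k + 1 + 1)
        = (x ^ (k + 1) - y ^ (k + 1)) * x + y ^ (k + 1) * (x - y) := by
      rw [pow_succ x, pow_succ y]
      noncomm_ring
    rw [e]
    exact (ih.mul hx).add (((hy.pow (k + 1)).mul h).mono (by omega))

/-- The exponential agrees with `1 + x` to first order in a perturbation of `x`. -/
theorem isOrd_pexp_sub_pexp {x y : MvPowerSeries σ R} (hx : IsOrd 1 x) (hy : IsOrd 1 y) {n : ℕ}
    (h : IsOrd n (x - y)) : IsOrd (n + 1) (pexp F x - pexp F y - (x - y)) := fun e he => by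
  rw [map_sub, map_sub, pexp, pexp,
    coeff_gradedSum (isOrd_pexp_term hx) (N := e.degree + 2) (by omega),
    coeff_gradedSum (isOrd_pexp_term hy) (N := e.degree + 2) (by omega),
    ← Finset.sum_sub_distrib, Finset.sum_range_succ', Finset.sum_range_succ']
  rw [Finset.sum_eq_zero]
  · simp
  · intro k _
    rw [← map_sub, ← smul_sub]
    exact ((pow_sub_pow_isOrd hx hy h (k + 1)).mono (by omega)).smul _ e he

theorem isOrd_pexp_sub_one {x : MvPowerSeries σ R} (hx : IsOrd 1 x) : IsOrd 1 (pexp F x - 1) :=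
  fun e he => by
    have := isOrd_gradedSum_sub (isOrd_pexp_term (F := F) hx) 1 e he
    simpa [pexp] using this

/-- If two products of exponentials agree and the exponents agree below degree `n`, then the sums
of the exponents agree in degree `n`. -/
theorem isOrd_add_sub_add {x y x' y' : MvPowerSeries σ R} (hx : IsOrd 1 x) (hy : IsOrd 1 y)
    (hx' : IsOrd 1 x') (hy' : IsOrd 1 y') {n : ℕ} (h1 : IsOrd n (x - x')) (h2 : IsOrd n (y - y'))
    (h : pexp F x * pexp F y = pexp F x' * pexp F y') : IsOrd (n + 1) ((x + y) - (x' + y')) := by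
  have d1 := isOrd_pexp_sub_pexp (F := F) hx hx' h1
  have d2 := isOrd_pexp_sub_pexp (F := F) hy hy' h2
  have e1 : IsOrd n (pexp F x - pexp F x') := by
    simpa using (d1.mono (Nat.le_succ n)).add h1
  have e2 : IsOrd n (pexp F y - pexp F y') := by
    simpa using (d2.mono (Nat.le_succ n)).add h2
  -- The difference of the products is expanded around `1`. Each cross term pairs a factor of order
  -- `n` with one of order `1`, so only the linear terms survive in degree `n`.
  have key : (x + y) - (x' + y') = (pexp F x * pexp F y - pexp F x' * pexp F y')
      - (pexp F x - pexp F x' - (x - x')) - (pexp F y - pexp F y' - (y - y'))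
      - (pexp F x - pexp F x') * (pexp F y - 1) - (pexp F x' - 1) * (pexp F y - pexp F y') := by
    noncomm_ring
  rw [key, h, sub_self]
  refine (((IsOrd.sub (fun e _ => map_zero _) d1).sub d2).sub
    (e1.mul (isOrd_pexp_sub_one hy))).sub ?_
  rw [add_comm]
  exact (isOrd_pexp_sub_one hx').mul e2

end Uniqueness

/-! ### Normalized operations on words and their grading. -/

namespace Word

/-- The number of letters of a word. -/
def deg (w : Word) : ℕ := w.degNeg + w.degPos

/-- The words that consist of a single letter or contain both letters. -/
def Good (w : Word) : Prop := w = neg ∨ w = pos ∨ (1 ≤ w.degNeg ∧ 1 ≤ w.degPos)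

/-- The bracket of two words, up to the relations `[neg, neg] = [pos, pos] = 0` and
`[neg, pos] = -[pos, neg]`. -/
noncomputable def nbrWord (v w : Word) : Word →₀ ℚ :=
  if v = w then 0 else if v = neg ∧ w = pos then -Finsupp.single (br pos neg) 1
    else Finsupp.single (br v w) 1

/-- The symbol `π⁻` applied to a word, up to `π⁻ neg = neg` and `π⁻ pos = 0`. -/
noncomputable def nnegWord (w : Word) : Word →₀ ℚ :=
  if w = neg then Finsupp.single neg 1 else if w = pos then 0 else Finsupp.single (projNeg w) 1

/-- The symbol `π⁺` applied to a word, up to `π⁺ neg = 0` and `π⁺ pos = pos`. -/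
noncomputable def nposWord (w : Word) : Word →₀ ℚ :=
  if w = pos then Finsupp.single pos 1 else if w = neg then 0 else Finsupp.single (projPos w) 1

/-- The bilinear extension of `nbrWord`. -/
noncomputable def nbr : (Word →₀ ℚ) →ₗ[ℚ] (Word →₀ ℚ) →ₗ[ℚ] (Word →₀ ℚ) :=
  Finsupp.linearCombination ℚ fun v => Finsupp.linearCombination ℚ fun w => nbrWord v w

/-- The linear extension of `nnegWord`. -/
noncomputable def nneg : (Word →₀ ℚ) →ₗ[ℚ] (Word →₀ ℚ) := Finsupp.linearCombination ℚ nnegWord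

/-- The linear extension of `nposWord`. -/
noncomputable def npos : (Word →₀ ℚ) →ₗ[ℚ] (Word →₀ ℚ) := Finsupp.linearCombination ℚ nposWord

theorem nbr_single (v w : Word) :
    nbr (Finsupp.single v 1) (Finsupp.single w 1) = nbrWord v w := by
  simp [nbr]

theorem nneg_single (w : Word) : nneg (Finsupp.single w 1) = nnegWord w := by simp [nneg]

theorem npos_single (w : Word) : npos (Finsupp.single w 1) = nposWord w := by simp [npos]

/-- Linear combinations of good words of degree `n`. -/
def graded (n : ℕ) : Submodule ℚ (Word →₀ ℚ) :=
  Finsupp.supported ℚ ℚ {w | w.Good ∧ w.deg = n}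

theorem single_mem_graded {w : Word} (hw : w.Good) (c : ℚ) : Finsupp.single w c ∈ graded w.deg :=
  Finsupp.single_mem_supported ℚ c ⟨hw, rfl⟩

theorem good_deg_of_mem_graded {n : ℕ} {p : Word →₀ ℚ} (hp : p ∈ graded n) {w : Word}
    (hw : p w ≠ 0) : w.Good ∧ w.deg = n :=
  (Finsupp.mem_supported ℚ p).mp hp (Finsupp.mem_support_iff.mpr hw)

/-- The only brackets of good words that miss a letter are `[neg, neg]` and `[pos, pos]`; these are
among the brackets that `nbrWord` sets to zero. -/
theorem Good.br {v w : Word} (hv : v.Good) (hw : w.Good) (hvw : v ≠ w) : (br v w).Good := by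
  refine Or.inr (Or.inr ?_)
  rcases hv with rfl | rfl | hv <;> rcases hw with rfl | rfl | hw <;>
    (simp_all [degNeg, degPos]; try omega)

theorem nbrWord_mem {v w : Word} (hv : v.Good) (hw : w.Good) :
    nbrWord v w ∈ graded (v.deg + w.deg) := by
  have hdeg : v.deg + w.deg = (br v w).deg := by
    simp only [deg, degNeg, degPos]
    omega
  rw [nbrWord]
  split_ifs with h1 h2
  · exact Submodule.zero_mem _
  · obtain ⟨rfl, rfl⟩ := h2
    exact Submodule.neg_mem _ (single_mem_graded (w := Word.br pos neg)
      (Or.inr (Or.inr ⟨le_rfl, le_rfl⟩)) 1)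
  · rw [hdeg]
    exact single_mem_graded (hv.br hw h1) 1

theorem Good.mixed {w : Word} (hw : w.Good) (h1 : w ≠ neg) (h2 : w ≠ pos) :
    1 ≤ w.degNeg ∧ 1 ≤ w.degPos := (hw.resolve_left h1).resolve_left h2

theorem linearCombination_mem_graded {f : Word → Word →₀ ℚ} {n m : ℕ} {p : Word →₀ ℚ}
    (hp : p ∈ graded n) (hf : ∀ w, w.Good → w.deg = n → f w ∈ graded m) :
    Finsupp.linearCombination ℚ f p ∈ graded m := by
  rw [Finsupp.linearCombination_apply]
  refine Submodule.sum_mem _ fun w hw => Submodule.smul_mem _ _ ?_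
  have := good_deg_of_mem_graded hp (Finsupp.mem_support_iff.mp hw)
  exact hf w this.1 this.2

theorem nbr_mem {p q : Word →₀ ℚ} {m n : ℕ} (hp : p ∈ graded m) (hq : q ∈ graded n) :
    nbr p q ∈ graded (m + n) := by
  rw [nbr, Finsupp.linearCombination_apply, Finsupp.sum, LinearMap.sum_apply]
  refine Submodule.sum_mem _ fun v hv => Submodule.smul_mem _ _ ?_
  obtain ⟨hv, rfl⟩ := good_deg_of_mem_graded hp (Finsupp.mem_support_iff.mp hv)
  refine linearCombination_mem_graded hq fun w hw hw' => ?_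
  rw [← hw']
  exact nbrWord_mem hv hw

theorem nneg_mem {p : Word →₀ ℚ} {n : ℕ} (hp : p ∈ graded n) : nneg p ∈ graded n := by
  refine linearCombination_mem_graded hp fun w hw hn => ?_
  rw [nnegWord]
  split_ifs with h1 h2
  · subst h1 hn
    exact single_mem_graded hw 1
  · exact Submodule.zero_mem _
  · subst hn
    exact single_mem_graded (w := projNeg w) (Or.inr (Or.inr (hw.mixed h1 h2))) 1

theorem npos_mem {p : Word →₀ ℚ} {n : ℕ} (hp : p ∈ graded n) : npos p ∈ graded n := by
  refine linearCombination_mem_graded hp fun w hw hn => ?_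
  rw [nposWord]
  split_ifs with h1 h2
  · subst h1 hn
    exact single_mem_graded hw 1
  · exact Submodule.zero_mem _
  · subst hn
    exact single_mem_graded (w := projPos w) (Or.inr (Or.inr (hw.mixed h2 h1))) 1

end Word

/-! ### The universal recursion, solved among words. -/

open Word

/-- Sequences of linear combinations of words, thought of as power series in a variable `τ`. -/
abbrev WordSeq := ℕ → Word →₀ ℚ

namespace WordSeq

/-- The Cauchy product formed with the bracket of words. -/
noncomputable def br (Q Y : WordSeq) : WordSeq :=
  fun n => ∑ p ∈ Finset.HasAntidiagonal.antidiagonal n, nbr (Q p.1) (Y p.2)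

/-- The value at `ad Q` of the power series with coefficients `c`, applied to `Y`. -/
noncomputable def ad (c : ℕ → ℚ) (Q Y : WordSeq) : WordSeq :=
  fun n => ∑ k ∈ Finset.range (n + 1), c k • (br Q)^[k] Y n

/-- The derivative with respect to `τ`. -/
noncomputable def der (P : WordSeq) : WordSeq := fun n => ((n : ℚ) + 1) • P (n + 1)

/-- The logarithmic derivative of `e ^ P e ^ Q`. -/
noncomputable def logDer (P Q : WordSeq) : WordSeq :=
  ad (expNegCoeff ℚ) Q (ad (phiCoeff ℚ) P (der P)) + ad (phiCoeff ℚ) Q (der Q)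

/-- The sequence `w τ`. -/
noncomputable def linear (w : Word) : WordSeq := fun n => if n = 1 then Finsupp.single w 1 else 0

theorem iterate_br_congr {Q Q' Y Y' : WordSeq} {n : ℕ} (hQ : ∀ i ≤ n, Q i = Q' i)
    (hY : ∀ i ≤ n, Y i = Y' i) (k : ℕ) : ∀ i ≤ n, (br Q)^[k] Y i = (br Q')^[k] Y' i := by
  induction k with
  | zero => exact hY
  | succ k ih =>
    intro i hi
    rw [Function.iterate_succ_apply', Function.iterate_succ_apply']
    refine Finset.sum_congr rfl fun p hp => ?_
    have := Finset.HasAntidiagonal.mem_antidiagonal.mp hp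
    rw [hQ _ (by omega), ih _ (by omega)]

theorem ad_congr (c : ℕ → ℚ) {Q Q' Y Y' : WordSeq} {n : ℕ} (hQ : ∀ i ≤ n, Q i = Q' i)
    (hY : ∀ i ≤ n, Y i = Y' i) : ad c Q Y n = ad c Q' Y' n :=
  Finset.sum_congr rfl fun k _ => by rw [iterate_br_congr hQ hY k n le_rfl]

/-- Because `c 0 = 1`, subtracting `Y n` leaves only terms with a bracket by `Q`. Since `Q 0 = 0`,
that bracket uses up at least one degree, so `Y n` itself no longer enters. -/
theorem ad_sub_congr {c : ℕ → ℚ} (hc : c 0 = 1) {Q Q' Y Y' : WordSeq} {n : ℕ} (h0 : Q 0 = 0)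
    (hQ : ∀ i ≤ n, Q i = Q' i) (hY : ∀ i < n, Y i = Y' i) :
    ad c Q Y n - Y n = ad c Q' Y' n - Y' n := by
  have key : ∀ Q Y : WordSeq, ad c Q Y n - Y n =
      ∑ k ∈ Finset.range n, c (k + 1) • br Q ((br Q)^[k] Y) n := by
    intro Q Y
    rw [ad, Finset.sum_range_succ']
    simp [hc, Function.iterate_succ_apply']
  rw [key, key]
  refine Finset.sum_congr rfl fun k _ => ?_
  congr 1
  refine Finset.sum_congr rfl fun p hp => ?_
  have hp' := Finset.HasAntidiagonal.mem_antidiagonal.mp hp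
  rw [← hQ _ (by omega)]
  rcases Nat.eq_zero_or_pos p.1 with h | h
  · rw [h, h0, map_zero, LinearMap.zero_apply, LinearMap.zero_apply]
  · rw [iterate_br_congr (n := p.2) (fun i hi => hQ i (by omega)) (fun i hi => hY i (by omega)) k
      _ le_rfl]

theorem expNegCoeff_zero : expNegCoeff ℚ 0 = 1 := by simp [expNegCoeff]

theorem phiCoeff_zero : phiCoeff ℚ 0 = 1 := by simp [phiCoeff]

/-- The nonlinear part at index `n` does not see `P (n + 1)` and `Q (n + 1)`, which enter through
`der` alone; this makes the differential equation a recursion. -/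
theorem logDer_sub_congr {P P' Q Q' : WordSeq} {n : ℕ} (hP0 : P 0 = 0) (hQ0 : Q 0 = 0)
    (hP : ∀ i ≤ n, P i = P' i) (hQ : ∀ i ≤ n, Q i = Q' i) :
    logDer P Q n - der P n - der Q n = logDer P' Q' n - der P' n - der Q' n := by
  have hdP : ∀ i < n, der P i = der P' i := fun i hi => by rw [der, der, hP _ (by omega)]
  have hdQ : ∀ i < n, der Q i = der Q' i := fun i hi => by rw [der, der, hQ _ (by omega)]
  have h1 := ad_sub_congr phiCoeff_zero hP0 hP hdP
  have h2 := ad_sub_congr phiCoeff_zero hQ0 hQ hdQ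
  have h3 := ad_sub_congr expNegCoeff_zero hQ0 hQ fun i hi =>
    ad_congr (phiCoeff ℚ) (n := i) (fun j hj => hP j (by omega)) fun j hj => hdP j (by omega)
  simp only [logDer, Pi.add_apply]
  linear_combination (norm := module) h1 + h2 + h3

theorem ad_zero {c : ℕ → ℚ} (hc : c 0 = 1) (Q Y : WordSeq) : ad c Q Y 0 = Y 0 := by
  simp [ad, hc]

theorem ad_one {c : ℕ → ℚ} (hc : c 0 = 1) {Q : WordSeq} (hQ : Q 0 = 0) (Y : WordSeq) :
    ad c Q Y 1 = Y 1 + c 1 • nbr (Q 1) (Y 0) := by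
  simp [ad, Finset.sum_range_succ, hc, br, Finset.Nat.antidiagonal_succ, hQ]

theorem logDer_zero (P Q : WordSeq) : logDer P Q 0 = P 1 + Q 1 := by
  simp [logDer, ad_zero expNegCoeff_zero, ad_zero phiCoeff_zero, der]

theorem logDer_one {P Q : WordSeq} (hP : P 0 = 0) (hQ : Q 0 = 0) :
    logDer P Q 1 = der P 1 + der Q 1 + phiCoeff ℚ 1 • (nbr (P 1) (P 1) + nbr (Q 1) (Q 1))
      - nbr (Q 1) (P 1) := by
  have h : expNegCoeff ℚ 1 = -1 := by simp [expNegCoeff]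
  simp only [logDer, Pi.add_apply, ad_one expNegCoeff_zero hQ, ad_one phiCoeff_zero hQ,
    ad_one phiCoeff_zero hP, ad_zero phiCoeff_zero, h, der]
  simp only [Nat.cast_zero, zero_add, one_smul]
  module

/-- Homogeneity of a sequence, with a shift in degree. -/
def IsGraded (d : ℕ) (P : WordSeq) : Prop := ∀ n, P n ∈ graded (n + d)

theorem IsGraded.br {Q Y : WordSeq} {d : ℕ} (hQ : IsGraded 0 Q) (hY : IsGraded d Y) :
    IsGraded d (br Q Y) := fun n => by
  refine Submodule.sum_mem _ fun p hp => ?_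
  rw [← Finset.HasAntidiagonal.mem_antidiagonal.mp hp, add_assoc]
  exact nbr_mem (hQ _) (hY _)

theorem IsGraded.ad {Q Y : WordSeq} {d : ℕ} (c : ℕ → ℚ) (hQ : IsGraded 0 Q)
    (hY : IsGraded d Y) : IsGraded d (ad c Q Y) := fun n => by
  refine Submodule.sum_mem _ fun k _ => Submodule.smul_mem _ _ ?_
  have : ∀ k, IsGraded d ((WordSeq.br Q)^[k] Y) := by
    intro k
    induction k with
    | zero => exact hY
    | succ k ih =>
      rw [Function.iterate_succ_apply']
      exact hQ.br ih
  exact this k n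

theorem IsGraded.der {P : WordSeq} (hP : IsGraded 0 P) : IsGraded 1 (der P) := fun n =>
  Submodule.smul_mem _ _ (hP (n + 1))

theorem IsGraded.logDer {P Q : WordSeq} (hP : IsGraded 0 P) (hQ : IsGraded 0 Q) :
    IsGraded 1 (logDer P Q) := fun n =>
  Submodule.add_mem _ (hQ.ad _ (hP.ad _ hP.der) n) (hQ.ad _ hQ.der n)

theorem isGraded_linear_neg : IsGraded 0 (linear neg) := fun n => by
  rw [linear]
  split_ifs with h
  · subst h
    exact single_mem_graded (w := neg) (Or.inl rfl) 1
  · exact Submodule.zero_mem _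

theorem isGraded_linear_pos : IsGraded 0 (linear pos) := fun n => by
  rw [linear]
  split_ifs with h
  · subst h
    exact single_mem_graded (w := pos) (Or.inr (Or.inl rfl)) 1
  · exact Submodule.zero_mem _

/-- The logarithmic derivative of `e ^ (τ pos) e ^ (τ neg)`, less the part of the logarithmic
derivative of `e ^ P e ^ Q` that is nonlinear in `P` and `Q`. -/
noncomputable def rhs (P Q : WordSeq) : WordSeq :=
  fun n => logDer (linear pos) (linear neg) n - (logDer P Q n - der P n - der Q n)

theorem exists_solution : ∃ P Q : WordSeq, P 0 = 0 ∧ Q 0 = 0 ∧ IsGraded 0 P ∧ IsGraded 0 Q ∧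
    (∀ n, P (n + 1) = ((n : ℚ) + 1)⁻¹ • nneg (rhs P Q n)) ∧
    (∀ n, Q (n + 1) = ((n : ℚ) + 1)⁻¹ • npos (rhs P Q n)) := by
  -- The causality of `Φ` has to hold at arbitrary arguments, while `logDer_sub_congr` needs
  -- sequences that vanish at `0`; hence the forced zero.
  let fst' : (ℕ → (Word →₀ ℚ) × (Word →₀ ℚ)) → WordSeq := fun f n => if n = 0 then 0 else (f n).1
  let snd' : (ℕ → (Word →₀ ℚ) × (Word →₀ ℚ)) → WordSeq := fun f n => if n = 0 then 0 else (f n).2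
  let Φ : (ℕ → (Word →₀ ℚ) × (Word →₀ ℚ)) → ℕ → (Word →₀ ℚ) × (Word →₀ ℚ) := fun f n =>
    if n = 0 then 0 else
      ((n : ℚ)⁻¹ • nneg (rhs (fst' f) (snd' f) (n - 1)),
        (n : ℚ)⁻¹ • npos (rhs (fst' f) (snd' f) (n - 1)))
  obtain ⟨f, hf, hit⟩ := exists_fixedPoint_of_causal (fun n : ℕ => n) Φ (by
    intro n f h hfh i hi
    by_cases h0 : i = 0
    · simp only [Φ, if_pos h0]
    · have e : rhs (fst' f) (snd' f) (i - 1) = rhs (fst' h) (snd' h) (i - 1) := by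
        rw [rhs, rhs, logDer_sub_congr (if_pos rfl) (if_pos rfl)]
        · intro j hj
          simp only [fst', hfh j (by omega)]
        · intro j hj
          simp only [snd', hfh j (by omega)]
      simp only [Φ, if_neg h0, e])
  -- Homogeneity is proved for the iterates and inherited by the fixed point, each value of which is
  -- a value of an iterate.
  have hgr : ∀ n, ∀ i, (Φ^[n] 0 i).1 ∈ graded i ∧ (Φ^[n] 0 i).2 ∈ graded i := by
    intro n
    induction n with
    | zero => exact fun i => ⟨Submodule.zero_mem _, Submodule.zero_mem _⟩
    | succ n ih =>
      intro i
      rw [Function.iterate_succ_apply']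
      by_cases h0 : i = 0
      · simp only [Φ, if_pos h0]
        exact ⟨Submodule.zero_mem _, Submodule.zero_mem _⟩
      · have h1 : IsGraded 0 (fst' (Φ^[n] 0)) := fun j => by
          simp only [fst']
          split_ifs
          exacts [Submodule.zero_mem _, (ih j).1]
        have h2 : IsGraded 0 (snd' (Φ^[n] 0)) := fun j => by
          simp only [snd']
          split_ifs
          exacts [Submodule.zero_mem _, (ih j).2]
        have h3 : rhs (fst' (Φ^[n] 0)) (snd' (Φ^[n] 0)) (i - 1) ∈ graded (i - 1 + 1) :=
          Submodule.sub_mem _ (isGraded_linear_pos.logDer isGraded_linear_neg _)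
            (Submodule.sub_mem _ (Submodule.sub_mem _ (h1.logDer h2 _) (h1.der _)) (h2.der _))
        rw [Nat.sub_add_cancel (Nat.pos_of_ne_zero h0)] at h3
        simp only [Φ, if_neg h0]
        exact ⟨Submodule.smul_mem _ _ (nneg_mem h3), Submodule.smul_mem _ _ (npos_mem h3)⟩
  have hf0 : f 0 = 0 := by
    rw [← hf]
    exact if_pos rfl
  have e1 : fst' f = fun n => (f n).1 := by
    funext n
    simp only [fst']
    split_ifs with h
    · rw [h, hf0]
      rfl
    · rfl
  have e2 : snd' f = fun n => (f n).2 := by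
    funext n
    simp only [snd']
    split_ifs with h
    · rw [h, hf0]
      rfl
    · rfl
  have hs : ∀ n : ℕ, f (n + 1) =
      (((n : ℚ) + 1)⁻¹ • nneg (rhs (fun n => (f n).1) (fun n => (f n).2) n),
      ((n : ℚ) + 1)⁻¹ • npos (rhs (fun n => (f n).1) (fun n => (f n).2) n)) := fun n => by
    conv_lhs => rw [← hf]
    simp only [Φ, if_neg (Nat.succ_ne_zero n), e1, e2, Nat.add_sub_cancel]
    push_cast
    rfl
  refine ⟨fun n => (f n).1, fun n => (f n).2, congrArg Prod.fst hf0, congrArg Prod.snd hf0,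
    fun n => ?_, fun n => ?_, fun n => congrArg Prod.fst (hs n), fun n => congrArg Prod.snd (hs n)⟩
  · change (f n).1 ∈ graded n
    rw [hit n (n + 1) (Nat.lt_succ_self n)]
    exact (hgr _ n).1
  · change (f n).2 ∈ graded n
    rw [hit n (n + 1) (Nat.lt_succ_self n)]
    exact (hgr _ n).2

/-- The homogeneous components of `G⁻`. -/
noncomputable def solNeg : WordSeq := exists_solution.choose

/-- The homogeneous components of `G⁺`. -/
noncomputable def solPos : WordSeq := exists_solution.choose_spec.choose

theorem sol_spec : solNeg 0 = 0 ∧ solPos 0 = 0 ∧ IsGraded 0 solNeg ∧ IsGraded 0 solPos ∧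
    (∀ n, solNeg (n + 1) = ((n : ℚ) + 1)⁻¹ • nneg (rhs solNeg solPos n)) ∧
    (∀ n, solPos (n + 1) = ((n : ℚ) + 1)⁻¹ • npos (rhs solNeg solPos n)) :=
  exists_solution.choose_spec.choose_spec

theorem rhs_sol_zero : rhs solNeg solPos 0 = Finsupp.single pos 1 + Finsupp.single neg 1 := by
  rw [rhs, logDer_zero, logDer_zero]
  simp [linear, der]

theorem solNeg_one : solNeg 1 = Finsupp.single neg 1 := by
  have := sol_spec.2.2.2.2.1 0
  rw [rhs_sol_zero, map_add, nneg_single, nneg_single] at this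
  simpa [nnegWord] using this

theorem solPos_one : solPos 1 = Finsupp.single pos 1 := by
  have := sol_spec.2.2.2.2.2 0
  rw [rhs_sol_zero, map_add, npos_single, npos_single] at this
  simpa [nposWord] using this

/-- The two sides of the equation contribute `[pos, neg]` and `-[neg, pos]`, which `nbrWord` makes
the same word. The factor `2` cancels the `1 / 2` of the recursion. -/
theorem rhs_sol_one : rhs solNeg solPos 1 = (2 : ℚ) • Finsupp.single (Word.br pos neg) 1 := by
  rw [rhs, logDer_one sol_spec.1 sol_spec.2.1, logDer_one (by simp [linear]) (by simp [linear]),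
    solNeg_one, solPos_one]
  simp only [linear, if_true, nbr_single, der]
  have h1 : nbrWord neg neg = 0 := by simp [nbrWord]
  have h2 : nbrWord pos pos = 0 := by simp [nbrWord]
  have h3 : nbrWord neg pos = -Finsupp.single (Word.br pos neg) 1 := by simp [nbrWord]
  have h4 : nbrWord pos neg = Finsupp.single (Word.br pos neg) 1 := by simp [nbrWord]
  rw [h1, h2, h3, h4, if_neg (by norm_num), if_neg (by norm_num)]
  module

theorem solNeg_two : solNeg 2 = Finsupp.single (projNeg (Word.br pos neg)) 1 := by
  have := sol_spec.2.2.2.2.1 1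
  rw [rhs_sol_one, map_smul, nneg_single, smul_smul] at this
  norm_num [nnegWord] at this
  exact this

theorem solPos_two : solPos 2 = Finsupp.single (projPos (Word.br pos neg)) 1 := by
  have := sol_spec.2.2.2.2.2 1
  rw [rhs_sol_one, map_smul, npos_single, smul_smul] at this
  norm_num [nposWord] at this
  exact this

end WordSeq

/-! ### Passage to `U(g)[[s,t]]` and uniqueness of the factorization. -/

section Enveloping

variable (F : Type*) [Field F] {g : Type*} [LieRing g] [LieAlgebra F g]

theorem toEnveloping_add (x y : LieSeries g) :
    toEnveloping F (x + y) = toEnveloping F x + toEnveloping F y :=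
  funext fun _ => map_add _ _ _

theorem toEnveloping_sub (x y : LieSeries g) :
    toEnveloping F (x - y) = toEnveloping F x - toEnveloping F y :=
  funext fun _ => map_sub _ _ _

theorem toEnveloping_smul (c : F) (x : LieSeries g) :
    toEnveloping F (c • x) = c • toEnveloping F x :=
  funext fun _ => map_smul _ _ _

theorem coeff_toEnveloping (x : LieSeries g) (e : Fin 2 →₀ ℕ) :
    MvPowerSeries.coeff e (toEnveloping F x) = UniversalEnvelopingAlgebra.ι F (x e) := rfl

attribute [local instance] LieRing.ofAssociativeRing in
theorem ι_lie (x y : g) : UniversalEnvelopingAlgebra.ι F ⁅x, y⁆ =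
    UniversalEnvelopingAlgebra.ι F x * UniversalEnvelopingAlgebra.ι F y
      - UniversalEnvelopingAlgebra.ι F y * UniversalEnvelopingAlgebra.ι F x := by
  rw [LieHom.map_lie, LieRing.of_associative_ring_bracket]

theorem toEnveloping_bracket (x y : LieSeries g) :
    toEnveloping F (bracket x y) = comm (toEnveloping F x) (toEnveloping F y) := by
  ext e
  rw [comm, map_sub, MvPowerSeries.coeff_mul, MvPowerSeries.coeff_mul, coeff_toEnveloping,
    bracket, map_sum]
  rw [Finsupp.sum_antidiagonal_swap e fun p q => MvPowerSeries.coeff p (toEnveloping F y) *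
      MvPowerSeries.coeff q (toEnveloping F x), ← Finset.sum_sub_distrib]
  exact Finset.sum_congr rfl fun p _ => ι_lie F _ _

theorem degree_fin_two (e : Fin 2 →₀ ℕ) : e.degree = e 0 + e 1 := by
  rw [Finsupp.degree_eq_sum, Fin.sum_univ_two]

theorem expSeries_eq_pexp (x : LieSeries g) : expSeries F x = pexp F (toEnveloping F x) := by
  funext e
  rw [expSeries, ← degree_fin_two]
  rfl

theorem isOrd_toEnveloping {x : LieSeries g} {n : ℕ}
    (h : ∀ e : Fin 2 →₀ ℕ, e.degree < n → x e = 0) : IsOrd n (toEnveloping F x) := fun e he => by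
  rw [coeff_toEnveloping, h e he, map_zero]

theorem mulVar_eq_zero (i : Fin 2) (x : LieSeries g) {e : Fin 2 →₀ ℕ} (he : e.degree < 1) :
    mulVar i x e = 0 := by
  have : e = 0 := (Finsupp.degree_eq_zero_iff e).mp (by omega)
  simp [mulVar, this]

theorem mulVar_injective (i : Fin 2) : Function.Injective (mulVar i : LieSeries g → _) := by
  intro x y h
  funext e
  have := congrFun h (e + Finsupp.single i 1)
  simpa [mulVar] using this

theorem mulVar_mem {V : Submodule F g} {x : LieSeries g} (hx : x ∈ seriesIn V) (i : Fin 2) :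
    mulVar i x ∈ seriesIn V := fun e => by
  rw [mulVar]
  split_ifs
  exacts [V.zero_mem, hx _]

variable {F}

/-- Uniqueness of the factorization of a product of exponentials along a decomposition. -/
theorem eq_and_eq_of_expSeries_mul_eq [CharZero F] {gm gp : Submodule F g} (hc : IsCompl gm gp)
    {x x' y y' : LieSeries g} (hx : x ∈ seriesIn gm) (hx' : x' ∈ seriesIn gm)
    (hy : y ∈ seriesIn gp) (hy' : y' ∈ seriesIn gp)
    (x0 : ∀ e : Fin 2 →₀ ℕ, e.degree < 1 → x e = 0)
    (x0' : ∀ e : Fin 2 →₀ ℕ, e.degree < 1 → x' e = 0)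
    (y0 : ∀ e : Fin 2 →₀ ℕ, e.degree < 1 → y e = 0)
    (y0' : ∀ e : Fin 2 →₀ ℕ, e.degree < 1 → y' e = 0)
    (h : expSeries F x * expSeries F y = expSeries F x' * expSeries F y') : x = x' ∧ y = y' := by
  simp only [expSeries_eq_pexp] at h
  have key : ∀ n, ∀ e : Fin 2 →₀ ℕ, e.degree < n → x e = x' e ∧ y e = y' e := by
    intro n
    induction n with
    | zero => exact fun e he => absurd he (Nat.not_lt_zero _)
    | succ n ih =>
      intro e he
      have h1 := isOrd_toEnveloping F (x := x - x') (n := n) fun e he =>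
        sub_eq_zero.mpr (ih e he).1
      have h2 := isOrd_toEnveloping F (x := y - y') (n := n) fun e he =>
        sub_eq_zero.mpr (ih e he).2
      rw [toEnveloping_sub] at h1 h2
      have h3 := isOrd_add_sub_add (isOrd_toEnveloping F x0) (isOrd_toEnveloping F y0)
        (isOrd_toEnveloping F x0') (isOrd_toEnveloping F y0') h1 h2 h e he
      rw [← toEnveloping_add, ← toEnveloping_add, ← toEnveloping_sub, coeff_toEnveloping,
        ← map_zero (UniversalEnvelopingAlgebra.ι F)] at h3
      have h4 : x e + y e - (x' e + y' e) = 0 := universalEnveloping_ι_injective F h3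
      -- The left side lies in `gm` and the right side in `gp`, so both vanish.
      have h5 : x e - x' e = y' e - y e := by
        rw [← sub_eq_zero, ← h4]
        abel
      have h6 : x e - x' e = 0 := Submodule.disjoint_def.mp hc.disjoint _
        (gm.sub_mem (hx e) (hx' e)) (h5 ▸ gp.sub_mem (hy' e) (hy e))
      exact ⟨sub_eq_zero.mp h6, (sub_eq_zero.mp (h5.symm.trans h6)).symm⟩
  exact ⟨funext fun e => (key _ e (Nat.lt_succ_self _)).1,
    funext fun e => (key _ e (Nat.lt_succ_self _)).2⟩

end Enveloping

section Projection

variable {F : Type*} [Field F] {g : Type*} [LieRing g] [LieAlgebra F g]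
  {gm gp : Submodule F g} (hc : IsCompl gm gp)

/-- `π⁻` as a linear map. -/
noncomputable def projNegLin : LieSeries g →ₗ[F] LieSeries g where
  toFun := projNegSeries hc
  map_add' _ _ := funext fun _ => map_add _ _ _
  map_smul' _ _ := funext fun _ => map_smul _ _ _

/-- `π⁺` as a linear map. -/
noncomputable def projPosLin : LieSeries g →ₗ[F] LieSeries g where
  toFun := projPosSeries hc
  map_add' _ _ := funext fun _ => map_add _ _ _
  map_smul' _ _ := funext fun _ => map_smul _ _ _

theorem projNegSeries_mem (x : LieSeries g) : projNegSeries hc x ∈ seriesIn gm := fun e =>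
  Submodule.projection_apply_mem hc (x e)

theorem projPosSeries_mem (x : LieSeries g) : projPosSeries hc x ∈ seriesIn gp := fun e =>
  Submodule.projection_apply_mem hc.symm (x e)

theorem projNegSeries_add_projPosSeries (x : LieSeries g) :
    projNegSeries hc x + projPosSeries hc x = x :=
  funext fun e => Submodule.projection_add_projection_eq_self hc (x e)

end Projection

/-! ### Evaluating words, and the factorization over `τ`. -/

section Evaluation

variable {F : Type*} [Field F] [CharZero F] {g : Type*} [LieRing g] [LieAlgebra F g]
  {gm gp : Submodule F g} (hc : IsCompl gm gp) (a b : LieSeries g)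

/-- The value in `g[[s,t]]` of a linear combination of words. -/
noncomputable def evalWords : (Word →₀ ℚ) →ₛₗ[algebraMap ℚ F] LieSeries g where
  toFun p := p.sum fun w c => (c : F) • w.eval hc a b
  map_add' p q := Finsupp.sum_add_index' (by simp) (by simp [add_smul])
  map_smul' c p := by
    rw [Finsupp.sum_smul_index' (by simp), Finsupp.smul_sum]
    refine Finsupp.sum_congr fun w _ => ?_
    rw [smul_smul]
    simp

theorem evalWords_apply (p : Word →₀ ℚ) :
    evalWords hc a b p = p.sum fun w c => (c : F) • w.eval hc a b := rfl

theorem evalWords_single (w : Word) :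
    evalWords hc a b (Finsupp.single w 1) = w.eval hc a b := by
  simp [evalWords_apply]

theorem evalWords_linearCombination (f : Word → Word →₀ ℚ) (p : Word →₀ ℚ) :
    evalWords hc a b (Finsupp.linearCombination ℚ f p) =
      p.sum fun w c => (c : F) • evalWords hc a b (f w) := by
  rw [Finsupp.linearCombination_apply, Finsupp.sum, map_sum]
  exact Finset.sum_congr rfl fun w _ => by rw [map_smulₛₗ]; rfl

variable {a b}

/-- The rules `π⁻ neg = neg` and `π⁻ pos = 0` built into `nneg` become true upon substitution
precisely because `a` lies in the minus part and `b` in the plus part. -/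
theorem evalWords_nneg (ha : a ∈ seriesIn gm) (hb : b ∈ seriesIn gp) (p : Word →₀ ℚ) :
    evalWords hc a b (Word.nneg p) = projNegSeries hc (evalWords hc a b p) := by
  rw [Word.nneg, evalWords_linearCombination, evalWords_apply hc a b p]
  change _ = projNegLin hc _
  rw [Finsupp.sum, Finsupp.sum, map_sum]
  refine Finset.sum_congr rfl fun w _ => ?_
  rw [map_smul]
  congr 1
  rw [Word.nnegWord]
  split_ifs with h1 h2
  · rw [h1, evalWords_single]
    exact funext fun e => (Submodule.projection_apply_of_mem_left hc (ha e)).symm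
  · rw [h2, map_zero]
    exact funext fun e => ((Submodule.projection_apply_eq_zero_iff hc).mpr (hb e)).symm
  · exact evalWords_single hc a b _

theorem evalWords_npos (ha : a ∈ seriesIn gm) (hb : b ∈ seriesIn gp) (p : Word →₀ ℚ) :
    evalWords hc a b (Word.npos p) = projPosSeries hc (evalWords hc a b p) := by
  rw [Word.npos, evalWords_linearCombination, evalWords_apply hc a b p]
  change _ = projPosLin hc _
  rw [Finsupp.sum, Finsupp.sum, map_sum]
  refine Finset.sum_congr rfl fun w _ => ?_
  rw [map_smul]
  congr 1
  rw [Word.nposWord]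
  split_ifs with h1 h2
  · rw [h1, evalWords_single]
    exact funext fun e => (Submodule.projection_apply_of_mem_left hc.symm (hb e)).symm
  · rw [h2, map_zero]
    exact funext fun e => ((Submodule.projection_apply_eq_zero_iff hc.symm).mpr (ha e)).symm
  · exact evalWords_single hc a b _

variable (a b)

/-- The value in `U(g)[[s,t]]` of a linear combination of words. -/
noncomputable def envWords :
    (Word →₀ ℚ) →ₛₗ[algebraMap ℚ F] MvPowerSeries (Fin 2) (UniversalEnvelopingAlgebra F g) where
  toFun p := toEnveloping F (evalWords hc a b p)
  map_add' p q := by rw [map_add, toEnveloping_add]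
  map_smul' c p := by rw [map_smulₛₗ, toEnveloping_smul]

/-- The simplifications in `nbrWord` are instances of the antisymmetry of the commutator. -/
theorem envWords_nbrWord (v w : Word) : envWords hc a b (Word.nbrWord v w) =
    comm (toEnveloping F (v.eval hc a b)) (toEnveloping F (w.eval hc a b)) := by
  rw [Word.nbrWord]
  split_ifs with h1 h2
  · rw [h1, map_zero, comm, sub_self]
  · obtain ⟨rfl, rfl⟩ := h2
    rw [map_neg]
    change -toEnveloping F (evalWords hc a b _) = _
    rw [evalWords_single]
    change -toEnveloping F (bracket b a) = comm (toEnveloping F a) (toEnveloping F b)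
    rw [toEnveloping_bracket, comm, comm, neg_sub]
  · change toEnveloping F (evalWords hc a b _) = _
    rw [evalWords_single, Word.eval, toEnveloping_bracket]

theorem envWords_apply (p : Word →₀ ℚ) : envWords hc a b p =
    p.sum fun w c => (c : F) • toEnveloping F (w.eval hc a b) := by
  conv_lhs => rw [← Finsupp.sum_single p, Finsupp.sum, map_sum]
  refine Finset.sum_congr rfl fun w _ => ?_
  rw [← mul_one (p w), ← smul_eq_mul, ← Finsupp.smul_single, map_smulₛₗ]
  change _ • toEnveloping F (evalWords hc a b _) = _
  rw [evalWords_single]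
  simp

theorem envWords_nbr (p q : Word →₀ ℚ) :
    envWords hc a b (Word.nbr p q) = comm (envWords hc a b p) (envWords hc a b q) := by
  have h1 : ∀ v, envWords hc a b (Finsupp.linearCombination ℚ (fun w => Word.nbrWord v w) q) =
      comm (toEnveloping F (v.eval hc a b)) (envWords hc a b q) := fun v => by
    rw [Finsupp.linearCombination_apply, Finsupp.sum, map_sum, envWords_apply hc a b q, comm,
      Finsupp.sum, Finset.mul_sum, Finset.sum_mul, ← Finset.sum_sub_distrib]
    refine Finset.sum_congr rfl fun w _ => ?_
    rw [map_smulₛₗ, envWords_nbrWord, comm, mul_smul_comm, smul_mul_assoc, smul_sub]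
    rfl
  rw [Word.nbr, Finsupp.linearCombination_apply, Finsupp.sum, LinearMap.sum_apply, map_sum,
    envWords_apply hc a b p, comm, Finsupp.sum, Finset.mul_sum, Finset.sum_mul,
    ← Finset.sum_sub_distrib]
  refine Finset.sum_congr rfl fun v _ => ?_
  rw [LinearMap.smul_apply, map_smulₛₗ, h1, comm, mul_smul_comm, smul_mul_assoc, smul_sub]
  rfl

/-- The power series in `τ` with values in `U(g)[[s,t]]` given by a sequence. -/
noncomputable def envSeq (Y : WordSeq) :
    PowerSeries (MvPowerSeries (Fin 2) (UniversalEnvelopingAlgebra F g)) :=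
  PowerSeries.mk fun n => envWords hc a b (Y n)

theorem coeff_envSeq (Y : WordSeq) (n : ℕ) :
    PowerSeries.coeff n (envSeq hc a b Y) = envWords hc a b (Y n) := PowerSeries.coeff_mk _ _

theorem envSeq_add (Y Z : WordSeq) :
    envSeq hc a b (Y + Z) = envSeq hc a b Y + envSeq hc a b Z := by
  ext1 n
  rw [map_add, coeff_envSeq, coeff_envSeq, coeff_envSeq, ← map_add]
  rfl

theorem envSeq_br (Q Y : WordSeq) :
    envSeq hc a b (Q.br Y) = comm (envSeq hc a b Q) (envSeq hc a b Y) := by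
  ext1 n
  rw [coeff_envSeq, WordSeq.br, map_sum, comm, map_sub, PowerSeries.coeff_mul,
    PowerSeries.coeff_mul,
    ← Finset.Nat.sum_antidiagonal_swap (n := n) (f := fun p =>
      PowerSeries.coeff p.1 (envSeq hc a b Y) * PowerSeries.coeff p.2 (envSeq hc a b Q)),
    ← Finset.sum_sub_distrib]
  refine Finset.sum_congr rfl fun p _ => ?_
  rw [envWords_nbr, coeff_envSeq, coeff_envSeq]
  simp only [Prod.fst_swap, Prod.snd_swap, coeff_envSeq]
  rfl

theorem envSeq_ad (c : ℕ → ℚ) (Q Y : WordSeq) :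
    envSeq hc a b (WordSeq.ad c Q Y) =
      adSeries (fun k => (c k : F)) (envSeq hc a b Q) (envSeq hc a b Y) := by
  have hit : ∀ k, envSeq hc a b ((WordSeq.br Q)^[k] Y) =
      (comm (envSeq hc a b Q))^[k] (envSeq hc a b Y) := by
    intro k
    induction k with
    | zero => rfl
    | succ k ih => rw [Function.iterate_succ_apply', Function.iterate_succ_apply', envSeq_br, ih]
  ext1 n
  rw [coeff_envSeq, WordSeq.ad, map_sum]
  change _ = ∑ k ∈ Finset.range ((Finsupp.single () n).degree + 1), _
  rw [Finsupp.degree_single]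
  refine Finset.sum_congr rfl fun k _ => ?_
  rw [map_smulₛₗ, ← coeff_envSeq, hit]
  rfl

theorem envSeq_der (P : WordSeq) :
    envSeq hc a b P.der = tderiv F (envSeq hc a b P) := by
  ext1 n
  rw [coeff_envSeq, WordSeq.der, map_smulₛₗ, coeff_tderiv, coeff_envSeq]
  simp

theorem envSeq_logDer (P Q : WordSeq) :
    envSeq hc a b (WordSeq.logDer P Q) =
      adSeries (expNegCoeff F) (envSeq hc a b Q)
          (adSeries (phiCoeff F) (envSeq hc a b P) (tderiv F (envSeq hc a b P)))
        + adSeries (phiCoeff F) (envSeq hc a b Q) (tderiv F (envSeq hc a b Q)) := by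
  have h1 : (fun k => (expNegCoeff ℚ k : F)) = expNegCoeff F := by
    funext k
    simp [expNegCoeff]
  have h2 : (fun k => (phiCoeff ℚ k : F)) = phiCoeff F := by
    funext k
    simp [phiCoeff]
  rw [WordSeq.logDer, envSeq_add, envSeq_ad, envSeq_ad, envSeq_ad, envSeq_der, envSeq_der, h1, h2]

theorem isOrd_envSeq {P : WordSeq} (h : P 0 = 0) : IsOrd 1 (envSeq hc a b P) :=
  isOrd_powerSeries.mpr fun n hn => by
    rw [coeff_envSeq, Nat.lt_one_iff.mp hn, h, map_zero]

variable {a b}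

/-- The two projected recursions add up to the unprojected equation, as `π⁻ + π⁺ = 1`. -/
theorem evalWords_sol_add (ha : a ∈ seriesIn gm) (hb : b ∈ seriesIn gp) (n : ℕ) :
    evalWords hc a b (WordSeq.solNeg.der n) + evalWords hc a b (WordSeq.solPos.der n) =
      evalWords hc a b (WordSeq.rhs WordSeq.solNeg WordSeq.solPos n) := by
  have h1 : ((n : ℚ) + 1) ≠ 0 := by exact_mod_cast Nat.succ_ne_zero n
  obtain ⟨-, -, -, -, hm, hp⟩ := WordSeq.sol_spec
  rw [WordSeq.der, WordSeq.der, hm, hp, smul_inv_smul₀ h1, smul_inv_smul₀ h1,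
    evalWords_nneg hc ha hb, evalWords_npos hc ha hb, projNegSeries_add_projPosSeries]

theorem envSeq_logDer_sol (ha : a ∈ seriesIn gm) (hb : b ∈ seriesIn gp) :
    envSeq hc a b (WordSeq.logDer WordSeq.solNeg WordSeq.solPos) =
      envSeq hc a b (WordSeq.logDer (WordSeq.linear .pos) (WordSeq.linear .neg)) := by
  ext1 n
  rw [coeff_envSeq, coeff_envSeq]
  have := congrArg (toEnveloping F) (evalWords_sol_add hc ha hb n)
  rw [toEnveloping_add] at this
  change envWords hc a b _ + envWords hc a b _ = envWords hc a b _ at this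
  rw [WordSeq.rhs, map_sub, map_sub, map_sub] at this
  rw [← sub_eq_zero] at this ⊢
  rw [← this]
  abel

theorem pexp_envSeq_sol (ha : a ∈ seriesIn gm) (hb : b ∈ seriesIn gp) :
    pexp F (envSeq hc a b (WordSeq.linear .pos)) * pexp F (envSeq hc a b (WordSeq.linear .neg)) =
      pexp F (envSeq hc a b WordSeq.solNeg) * pexp F (envSeq hc a b WordSeq.solPos) := by
  refine pexp_mul_pexp_eq F (isOrd_envSeq hc a b (by simp [WordSeq.linear]))
    (isOrd_envSeq hc a b (by simp [WordSeq.linear])) (isOrd_envSeq hc a b WordSeq.sol_spec.1)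
    (isOrd_envSeq hc a b WordSeq.sol_spec.2.1) ?_
  rw [← envSeq_logDer, ← envSeq_logDer, envSeq_logDer_sol hc ha hb]

end Evaluation

/-! ### From sequences to series of words, and their lowest terms. -/

namespace WordSeq

/-- The series of words whose homogeneous components are the terms of a sequence. -/
def toWordSeries (Y : WordSeq) : WordSeries ℚ where
  coeff w := Y w.deg w
  finite_bidegree j k := (Y (j + k)).support.finite_toSet.subset fun w hw => by
    obtain ⟨h, rfl, rfl⟩ := hw
    exact Finsupp.mem_support_iff.mpr h

/-- The terms of degree at least three. -/
noncomputable def tail (Y : WordSeq) : WordSeq := fun n => if 3 ≤ n then Y n else 0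

theorem IsGraded.tail {Y : WordSeq} (hY : IsGraded 0 Y) : IsGraded 0 (tail Y) := fun n => by
  rw [WordSeq.tail]
  split_ifs
  exacts [hY n, Submodule.zero_mem _]

theorem higherMixed_tail {Y : WordSeq} (hY : IsGraded 0 Y) :
    (toWordSeries (tail Y)).HigherMixed := fun w hw => by
  change tail Y w.deg w ≠ 0 at hw
  have h3 : 3 ≤ w.deg := by
    by_contra h
    exact hw (by rw [tail, if_neg h]; rfl)
  have hg := (good_deg_of_mem_graded (hY.tail w.deg) hw).1
  have hm := hg.mixed (fun h => by subst h; simp [deg, degNeg, degPos] at h3)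
    (fun h => by subst h; simp [deg, degNeg, degPos] at h3)
  exact ⟨hm.1, hm.2, h3⟩

theorem coeff_toWordSeries {Y : WordSeq} {u v : Word} (hu : u.deg = 1) (hv : v.deg = 2)
    (h0 : Y 0 = 0) (h1 : Y 1 = Finsupp.single u 1) (h2 : Y 2 = Finsupp.single v 1) (w : Word) :
    (toWordSeries Y).coeff w = (if w = u then 1 else 0) + (if w = v then 1 else 0)
      + (toWordSeries (tail Y)).coeff w := by
  have hne : ∀ {x : Word}, w.deg ≠ x.deg → w ≠ x := fun h e => h (by rw [e])
  change Y w.deg w = _ + _ + tail Y w.deg w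
  rw [tail]
  rcases hw : w.deg with _ | _ | _ | n
  · rw [if_neg (hne (by omega)), if_neg (hne (by omega)), h0]
    simp
  · rw [if_neg (c := w = v) (hne (by omega)), h1, Finsupp.single_apply]
    simp [eq_comm]
  · rw [if_neg (c := w = u) (hne (by omega)), h2, Finsupp.single_apply]
    simp [eq_comm]
  · rw [if_neg (hne (by omega)), if_neg (hne (by omega)), if_pos (by omega)]
    simp

/-- The only good word without `neg` is `pos`, of degree one, and it is absent from `solNeg 1`. This
is what makes `G⁻` divisible by `s`. -/
theorem one_le_degNeg_of_solNeg {n : ℕ} {w : Word} (h : solNeg n w ≠ 0) : 1 ≤ w.degNeg := by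
  obtain ⟨hg, hn⟩ := good_deg_of_mem_graded (sol_spec.2.2.1 n) h
  rcases hg with rfl | rfl | hm
  · exact le_rfl
  · rw [show n = 1 from hn.symm, solNeg_one] at h
    simp at h
  · exact hm.1

theorem one_le_degPos_of_solPos {n : ℕ} {w : Word} (h : solPos n w ≠ 0) : 1 ≤ w.degPos := by
  obtain ⟨hg, hn⟩ := good_deg_of_mem_graded (sol_spec.2.2.2.1 n) h
  rcases hg with rfl | rfl | hm
  · rw [show n = 1 from hn.symm, solPos_one] at h
    simp at h
  · exact le_rfl
  · exact hm.2

end WordSeq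

theorem exists_mulVar_eq {F : Type*} [Field F] {g : Type*} [LieRing g] [LieAlgebra F g]
    (i : Fin 2) {V : Submodule F g} {z : LieSeries g}
    (hz : z ∈ seriesIn V) (h : ∀ e : Fin 2 →₀ ℕ, e i = 0 → z e = 0) :
    ∃ x ∈ seriesIn V, mulVar i x = z := by
  refine ⟨fun e => z (e + Finsupp.single i 1), fun e => hz _, funext fun e => ?_⟩
  change (if e i = 0 then 0 else z (e - Finsupp.single i 1 + Finsupp.single i 1)) = z e
  split_ifs with he
  · rw [h e he]
  · rw [tsub_add_cancel_of_le]
    simpa [Nat.one_le_iff_ne_zero] using he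

/-! ### Summing the homogeneous components at `τ = 1`. -/

section Total

variable {F : Type*} [Field F] [CharZero F] {g : Type*} [LieRing g] [LieAlgebra F g]
  {gm gp : Submodule F g} (hc : IsCompl gm gp) (xm xp : LieSeries g)

/-- The sum of the values of the terms of a sequence. -/
noncomputable def total (Y : WordSeq) : LieSeries g :=
  fun e => ∑ n ∈ Finset.range (e.degree + 1),
    evalWords hc (mulVar 0 xm) (mulVar 1 xp) (Y n) e

theorem evalWords_apply_apply (a b : LieSeries g) (p : Word →₀ ℚ) (e : Fin 2 →₀ ℕ) :
    evalWords hc a b p e = ∑ w ∈ p.support, (p w : F) • w.eval hc a b e := by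
  rw [evalWords_apply, Finsupp.sum]
  exact Finset.sum_apply e p.support fun w => (p w : F) • w.eval hc a b

theorem evalWords_eq_zero {p : Word →₀ ℚ} {n : ℕ} (hp : p ∈ graded n) {e : Fin 2 →₀ ℕ}
    (he : e.degree < n) : evalWords hc (mulVar 0 xm) (mulVar 1 xp) p e = 0 := by
  rw [evalWords_apply_apply]
  refine Finset.sum_eq_zero fun w hw => ?_
  have := (good_deg_of_mem_graded hp (Finsupp.mem_support_iff.mp hw)).2
  rw [Word.deg] at this
  rw [degree_fin_two] at he
  rw [Word.eval_eq_zero hc xm xp w e (by omega), smul_zero]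

theorem total_apply {Y : WordSeq} (hY : Y.IsGraded 0) (e : Fin 2 →₀ ℕ) {N : ℕ}
    (hN : e.degree < N) : total hc xm xp Y e =
      ∑ n ∈ Finset.range N, evalWords hc (mulVar 0 xm) (mulVar 1 xp) (Y n) e :=
  Finset.sum_subset (Finset.range_subset_range.mpr hN) fun n _ hn =>
    evalWords_eq_zero hc xm xp (hY n) (by simpa using hn)

theorem toEnveloping_total (Y : WordSeq) : toEnveloping F (total hc xm xp Y) =
    specOne (envSeq hc (mulVar 0 xm) (mulVar 1 xp) Y) := by
  funext e
  refine (map_sum (UniversalEnvelopingAlgebra.ι F) _ _).trans (Finset.sum_congr rfl fun n _ => ?_)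
  exact congrArg (MvPowerSeries.coeff e) (coeff_envSeq hc (mulVar 0 xm) (mulVar 1 xp) Y n).symm

theorem isAdapted_envSeq {Y : WordSeq} (hY : Y.IsGraded 0) :
    IsAdapted (envSeq hc (mulVar 0 xm) (mulVar 1 xp) Y) := fun n => by
  rw [coeff_envSeq]
  exact isOrd_toEnveloping F fun e he => evalWords_eq_zero hc xm xp (hY n) he

theorem total_linear {u : Word} (hu : WordSeq.IsGraded 0 (WordSeq.linear u)) :
    total hc xm xp (WordSeq.linear u) = u.eval hc (mulVar 0 xm) (mulVar 1 xp) := by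
  funext e
  rw [total_apply hc xm xp hu e (N := e.degree + 2) (by omega),
    Finset.sum_eq_single_of_mem 1 (by simp)]
  · rw [WordSeq.linear, if_pos rfl, evalWords_single]
  · intro n _ hn
    rw [WordSeq.linear, if_neg hn, map_zero]
    rfl

theorem eval_toWordSeries {Y : WordSeq} (hY : Y.IsGraded 0) :
    (Y.toWordSeries.cast F).eval hc xm xp = total hc xm xp Y := by
  classical
  funext e
  change ∑ᶠ w : Word, ((Y w.deg w : ℚ) : F) • w.eval hc (mulVar 0 xm) (mulVar 1 xp) e = _
  have hdeg : ∀ n w, w ∈ (Y n).support → w.deg = n := fun n w hw =>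
    (good_deg_of_mem_graded (hY n) (Finsupp.mem_support_iff.mp hw)).2
  rw [finsum_eq_sum_of_support_subset (s := (Finset.range (e.degree + 1)).biUnion
    fun n => (Y n).support), Finset.sum_biUnion]
  · refine Finset.sum_congr rfl fun n _ => ?_
    rw [evalWords_apply_apply]
    exact Finset.sum_congr rfl fun w hw => by rw [hdeg n w hw]
  · intro m _ n _ hmn
    refine Finset.disjoint_left.mpr fun w hm hn => hmn ?_
    rw [← hdeg m w hm, hdeg n w hn]
  · intro w hw
    simp only [Finset.coe_biUnion, Set.mem_iUnion, Finset.mem_coe, Finset.mem_range]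
    refine ⟨w.deg, ?_, ?_⟩
    · by_contra h
      refine hw ?_
      rw [degree_fin_two, Word.deg] at h
      simp only
      rw [Word.eval_eq_zero hc xm xp w e (by omega), smul_zero]
    · refine Finsupp.mem_support_iff.mpr fun h => hw ?_
      simp only
      rw [h, Rat.cast_zero, zero_smul]

theorem total_eq_add_tail {Y : WordSeq} (hY : Y.IsGraded 0) {u v : Word} (h0 : Y 0 = 0)
    (h1 : Y 1 = Finsupp.single u 1) (h2 : Y 2 = Finsupp.single v 1) :
    total hc xm xp Y = u.eval hc (mulVar 0 xm) (mulVar 1 xp)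
      + v.eval hc (mulVar 0 xm) (mulVar 1 xp) + total hc xm xp Y.tail := by
  funext e
  change _ = u.eval hc (mulVar 0 xm) (mulVar 1 xp) e + v.eval hc (mulVar 0 xm) (mulVar 1 xp) e
    + total hc xm xp Y.tail e
  -- The range is long enough for the terms of degree `0`, `1`, `2` to be split off whatever `e` is.
  rw [total_apply hc xm xp hY e (N := e.degree + 1 + 1 + 1) (by omega),
    total_apply hc xm xp hY.tail e (N := e.degree + 1 + 1 + 1) (by omega)]
  have hE0 : evalWords hc (mulVar 0 xm) (mulVar 1 xp) 0 e = 0 := by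
    rw [map_zero]
    rfl
  rw [← evalWords_single hc _ _ u, ← evalWords_single hc _ _ v]
  let E : (Word →₀ ℚ) → g := fun p => evalWords hc (mulVar 0 xm) (mulVar 1 xp) p e
  change E 0 = 0 at hE0
  change ∑ n ∈ _, E (Y n) = E _ + E _ + ∑ n ∈ _, E (Y.tail n)
  clear_value E
  have ht : ∀ n, Y.tail (n + 1 + 1 + 1) = Y (n + 1 + 1 + 1) := fun n => if_pos (by omega)
  have h0' : Y.tail 0 = 0 := rfl
  have h1' : Y.tail (0 + 1) = 0 := rfl
  have h2' : Y.tail (0 + 1 + 1) = 0 := rfl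
  rw [Finset.sum_range_succ', Finset.sum_range_succ', Finset.sum_range_succ',
    Finset.sum_range_succ', Finset.sum_range_succ', Finset.sum_range_succ']
  simp only [ht, h0', h1', h2', hE0, h0, zero_add, Nat.reduceAdd, h1, h2]
  abel

theorem total_mem {Y : WordSeq} {V : Submodule F g}
    (h : ∀ n, evalWords hc (mulVar 0 xm) (mulVar 1 xp) (Y n) ∈ seriesIn V) :
    total hc xm xp Y ∈ seriesIn V := fun e => V.sum_mem fun n _ => h n e

theorem tail_mem {Y : WordSeq} {V : Submodule F g}
    (h : ∀ n, evalWords hc (mulVar 0 xm) (mulVar 1 xp) (Y n) ∈ seriesIn V) (n : ℕ) :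
    evalWords hc (mulVar 0 xm) (mulVar 1 xp) (Y.tail n) ∈ seriesIn V := by
  rw [WordSeq.tail]
  split_ifs
  · exact h n
  · rw [map_zero]
    exact fun _ => V.zero_mem

variable {xm xp}

theorem evalWords_solNeg_mem (hm : xm ∈ seriesIn gm) (hp : xp ∈ seriesIn gp) (n : ℕ) :
    evalWords hc (mulVar 0 xm) (mulVar 1 xp) (WordSeq.solNeg n) ∈ seriesIn gm := by
  rcases n with _ | n
  · rw [WordSeq.sol_spec.1, map_zero]
    exact fun _ => gm.zero_mem
  · rw [WordSeq.sol_spec.2.2.2.2.1, map_smulₛₗ,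
      evalWords_nneg hc (mulVar_mem F hm 0) (mulVar_mem F hp 1)]
    exact fun e => gm.smul_mem _ (projNegSeries_mem hc _ e)

theorem evalWords_solPos_mem (hm : xm ∈ seriesIn gm) (hp : xp ∈ seriesIn gp) (n : ℕ) :
    evalWords hc (mulVar 0 xm) (mulVar 1 xp) (WordSeq.solPos n) ∈ seriesIn gp := by
  rcases n with _ | n
  · rw [WordSeq.sol_spec.2.1, map_zero]
    exact fun _ => gp.zero_mem
  · rw [WordSeq.sol_spec.2.2.2.2.2, map_smulₛₗ,
      evalWords_npos hc (mulVar_mem F hm 0) (mulVar_mem F hp 1)]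
    exact fun e => gp.smul_mem _ (projPosSeries_mem hc _ e)

variable (xm xp)

theorem total_solNeg_eq_zero (e : Fin 2 →₀ ℕ) (he : e 0 = 0) :
    total hc xm xp WordSeq.solNeg e = 0 :=
  Finset.sum_eq_zero fun n _ => by
    rw [evalWords_apply_apply]
    refine Finset.sum_eq_zero fun w hw => ?_
    have := WordSeq.one_le_degNeg_of_solNeg (Finsupp.mem_support_iff.mp hw)
    rw [Word.eval_eq_zero hc xm xp w e (by omega), smul_zero]

theorem total_solPos_eq_zero (e : Fin 2 →₀ ℕ) (he : e 1 = 0) :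
    total hc xm xp WordSeq.solPos e = 0 :=
  Finset.sum_eq_zero fun n _ => by
    rw [evalWords_apply_apply]
    refine Finset.sum_eq_zero fun w hw => ?_
    have := WordSeq.one_le_degPos_of_solPos (Finsupp.mem_support_iff.mp hw)
    rw [Word.eval_eq_zero hc xm xp w e (by omega), smul_zero]

theorem expSeries_total {Y : WordSeq} (hY : Y.IsGraded 0) (h0 : Y 0 = 0) :
    expSeries F (total hc xm xp Y) =
      specOne (pexp F (envSeq hc (mulVar 0 xm) (mulVar 1 xp) Y)) := by
  rw [expSeries_eq_pexp, toEnveloping_total,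
    specOne_pexp F (isAdapted_envSeq hc xm xp hY) (isOrd_envSeq hc _ _ h0)]

variable {xm xp}

/-- The factorization of `e ^ (t x⁺) e ^ (s x⁻)`. -/
theorem expSeries_mul_expSeries (hm : xm ∈ seriesIn gm) (hp : xp ∈ seriesIn gp) :
    expSeries F (mulVar 1 xp) * expSeries F (mulVar 0 xm) =
      expSeries F (total hc xm xp WordSeq.solNeg) *
        expSeries F (total hc xm xp WordSeq.solPos) := by
  have hn := WordSeq.isGraded_linear_neg
  have hq := WordSeq.isGraded_linear_pos
  have e1 : mulVar 1 xp = total hc xm xp (WordSeq.linear .pos) :=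
    (total_linear hc xm xp hq).symm
  have e2 : mulVar 0 xm = total hc xm xp (WordSeq.linear .neg) :=
    (total_linear hc xm xp hn).symm
  obtain ⟨m0, p0, mg, pg, -, -⟩ := WordSeq.sol_spec
  have ad : ∀ {Y : WordSeq}, Y.IsGraded 0 → Y 0 = 0 →
      IsAdapted (pexp F (envSeq hc (mulVar 0 xm) (mulVar 1 xp) Y)) := fun hY h0 =>
    (isAdapted_envSeq hc xm xp hY).pexp F (isOrd_envSeq hc _ _ h0)
  conv_lhs => rw [e1, e2]
  rw [expSeries_total hc xm xp hq (by simp [WordSeq.linear]),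
    expSeries_total hc xm xp hn (by simp [WordSeq.linear]), expSeries_total hc xm xp mg m0,
    expSeries_total hc xm xp pg p0,
    ← specOne_mul (ad hq (by simp [WordSeq.linear])) (ad hn (by simp [WordSeq.linear])),
    ← specOne_mul (ad mg m0) (ad pg p0),
    pexp_envSeq_sol hc (mulVar_mem F hm 0) (mulVar_mem F hp 1)]

end Total

end FormalUniformization

/-! ### The uniformization theorem. -/

open FormalUniformization in
theorem corollary3p10 :
    -- the universal series `G⁻`, `G⁺` and their higher order parts
    ∃ Gm Gp Vm Vp : WordSeries ℚ,
      (∀ w, Gm.coeff w =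
        (if w = Word.neg then 1 else 0)
          + (if w = Word.projNeg (Word.br Word.pos Word.neg) then 1 else 0) + Vm.coeff w) ∧
      (∀ w, Gp.coeff w =
        (if w = Word.pos then 1 else 0)
          + (if w = Word.projPos (Word.br Word.pos Word.neg) then 1 else 0) + Vp.coeff w) ∧
      Vm.HigherMixed ∧ Vp.HigherMixed ∧
      ∀ (F : Type*) [Field F] [CharZero F] (g : Type*) [LieRing g] [LieAlgebra F g]
        (gm gp : Submodule F g) (hc : IsCompl gm gp) (xm xp : LieSeries g),
        xm ∈ seriesIn gm → xp ∈ seriesIn gp →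
        ∃ Ψm Ψp : LieSeries g,
          -- `Ψ⁻`, `Ψ⁺` are the unique solution of the uniformization equation
          (Ψm ∈ seriesIn gm ∧ Ψp ∈ seriesIn gp ∧
            expSeries F (mulVar 1 xp) * expSeries F (mulVar 0 xm) =
              expSeries F (mulVar 0 Ψm) * expSeries F (mulVar 1 Ψp)) ∧
          (∀ Φm Φp : LieSeries g, Φm ∈ seriesIn gm → Φp ∈ seriesIn gp →
            expSeries F (mulVar 1 xp) * expSeries F (mulVar 0 xm) =
              expSeries F (mulVar 0 Φm) * expSeries F (mulVar 1 Φp) →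
            Φm = Ψm ∧ Φp = Ψp) ∧
          -- membership in the completed algebra of words
          (mulVar 0 Ψm ∈ WordSeries.completion hc xm xp ∧
           mulVar 1 Ψp ∈ WordSeries.completion hc xm xp ∧
           -- the universal formulas
           mulVar 0 Ψm = (Gm.cast F).eval hc xm xp ∧
           mulVar 1 Ψp = (Gp.cast F).eval hc xm xp ∧
           -- the lowest order terms
           (Gm.cast F).eval hc xm xp = mulVar 0 xm
              + projNegSeries hc (bracket (mulVar 1 xp) (mulVar 0 xm))
              + (Vm.cast F).eval hc xm xp ∧
           (Gp.cast F).eval hc xm xp = mulVar 1 xp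
              + projPosSeries hc (bracket (mulVar 1 xp) (mulVar 0 xm))
              + (Vp.cast F).eval hc xm xp ∧
           (Vm.cast F).eval hc xm xp ∈
              WordSeries.completion hc xm xp ∩ seriesIn gm ∧
           (Vp.cast F).eval hc xm xp ∈
              WordSeries.completion hc xm xp ∩ seriesIn gp) := by
  open WordSeq in
  refine ⟨toWordSeries solNeg, toWordSeries solPos, toWordSeries (tail solNeg),
    toWordSeries (tail solPos),
    coeff_toWordSeries (u := .neg) (v := .projNeg (.br .pos .neg)) rfl rfl sol_spec.1 solNeg_one
      solNeg_two,
    coeff_toWordSeries (u := .pos) (v := .projPos (.br .pos .neg)) rfl rfl sol_spec.2.1 solPos_one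
      solPos_two,
    higherMixed_tail sol_spec.2.2.1, higherMixed_tail sol_spec.2.2.2.1, ?_⟩
  intro F _ _ g _ _ gm gp hc xm xp hm hp
  obtain ⟨m0, p0, mg, pg, -, -⟩ := WordSeq.sol_spec
  have hVm := total_mem hc xm xp (evalWords_solNeg_mem hc hm hp)
  have hVp := total_mem hc xm xp (evalWords_solPos_mem hc hm hp)
  -- The value of `G⁻` is divisible by `s` and that of `G⁺` by `t`; the quotients are `Ψ⁻` and `Ψ⁺`.
  obtain ⟨Ψm, hΨm, em⟩ := exists_mulVar_eq 0 hVm (total_solNeg_eq_zero hc xm xp)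
  obtain ⟨Ψp, hΨp, ep⟩ := exists_mulVar_eq 1 hVp (total_solPos_eq_zero hc xm xp)
  have heq := expSeries_mul_expSeries hc hm hp
  rw [← em, ← ep] at heq
  have gmeval := eval_toWordSeries hc xm xp mg
  have gpeval := eval_toWordSeries hc xm xp pg
  have vmeval := eval_toWordSeries hc xm xp mg.tail
  have vpeval := eval_toWordSeries hc xm xp pg.tail
  refine ⟨Ψm, Ψp, ⟨hΨm, hΨp, heq⟩, fun Φm Φp hΦm hΦp h => ?_, ⟨_, em.trans gmeval.symm⟩,
    ⟨_, ep.trans gpeval.symm⟩, em.trans gmeval.symm, ep.trans gpeval.symm, ?_, ?_,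
    ⟨⟨_, rfl⟩, ?_⟩, ⟨⟨_, rfl⟩, ?_⟩⟩
  -- The exponents carry a factor `s` or `t`, so they have no constant term, and that factor can be
  -- cancelled afterwards.
  · have := eq_and_eq_of_expSeries_mul_eq hc (mulVar_mem F hΦm 0) (mulVar_mem F hΨm 0)
      (mulVar_mem F hΦp 1) (mulVar_mem F hΨp 1) (fun _ => mulVar_eq_zero 0 _)
      (fun _ => mulVar_eq_zero 0 _) (fun _ => mulVar_eq_zero 1 _) (fun _ => mulVar_eq_zero 1 _)
      (h.symm.trans heq)
    exact ⟨mulVar_injective 0 this.1, mulVar_injective 1 this.2⟩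
  · rw [gmeval, vmeval]
    exact total_eq_add_tail hc xm xp mg m0 WordSeq.solNeg_one WordSeq.solNeg_two
  · rw [gpeval, vpeval]
    exact total_eq_add_tail hc xm xp pg p0 WordSeq.solPos_one WordSeq.solPos_two
  · rw [vmeval]
    exact total_mem hc xm xp (tail_mem hc xm xp (evalWords_solNeg_mem hc hm hp))
  · rw [vpeval]
    exact total_mem hc xm xp (tail_mem hc xm xp (evalWords_solPos_mem hc hm hp))
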